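/- **Setting.** All kets are unnormalised; let $|\phi\rangle=\sum_{i\in\{0,1\}}|i\rangle|i\rangle$. A *projector* is a linear map $P=\sum_{i,j,k}\alpha_{j,ik}|j\rangle\langle i|\langle k|$ from two qubits to one, with $\alpha_{j,ik}\in\mathbb C$ arbitrary. Let $\alpha^k$ be the $2\times2$ matrix $\langle j|\alpha^k|i\rangle=\alpha_{j,ik}$ and $\tilde\alpha^i$ its mirror image $\langle j|\tilde\alpha^i|k\rangle=\alpha_{j,ik}$. The valence bond state ($D=d=2$, three sites) of a projector $P_0$ with coefficients $\alpha$ is $|\psi\rangle=(1\otimes P_0\otimes 1)|\phi\rangle_{12}|\phi\rangle_{34}$. Let $|\psi_{12}\rangle$ be the state of the first two qubits after outcome $0$ of a $Z$-measurement on the third, and $|\psi_{23}\rangle$ the state of the last two qubits after outcome $0$ of a $Z$-measurement on the first. For $p\in[0,1]$ let $\rho(p)$ be $|\psi\rangle\langle\psi|$ after independent $Z$-errors of probability $p$ on each of the three qubits, and let $\rho_{12}(p)$, $\rho_{23}(p)$ be the two-qubit states obtained from $\rho(p)$ by the same measurements and outcomes. A state of $N$ qubits is *purifiable* to a ket $|\chi\rangle$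 if for every $\varepsilon>0$ there are $n$ and an LOCC protocol with postselection (SLOCC) among $N$ parties, each holding its qubit of $n$ copies, that succeeds with positive probability and then outputs a state of fidelity at least $1-\varepsilon$ with the normalisation of $|\chi\rangle$. The *divide and rebuild protocol* (DRPP) *works at $p$* if for every $\varepsilon>0$ two-party SLOCC protocols on copies of $\rho_{12}(p)$ and of $\rho_{23}(p)$ produce, with positive probability, states $\sigma$, $\tau$ of fidelity at least $1-\varepsilon$ with $|\phi\rangle$ and such that $(1\otimes P_0\otimes1)(\sigma\otimes\tau)(1\otimes P_0\otimes 1)^\dagger$ is non-zero and has, once normalised, fidelity at least $1-\varepsilon$ with $|\psi\rangle$. The DRPP is *optimal* for $P_0$ if for every $p\in[0,1]$: $\rho(p)$ is purifiable to $|\psi\rangle$ if and only if the DRPP works at $p$. A projector $P_1$, with coefficients $\beta$, *reconstructs $P_0$ from the edge $12$* if $(1\otimes P_1\otimes1)|\psi_{12}\rangle|\phi\rangle=|\psi\rangle$ and $(1\otimes P_1\otimes1)(1\otimes Z\otimes1\otimes1)|\psi_{12}\rangle|\phi\rangle=(1\otimes Z\otimes1)|\psi\rangle$; *from the edge $23$*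 if $(1\otimes P_1\otimes1)|\phi\rangle|\psi_{23}\rangle=|\psi\rangle$ and $(1\otimes P_1\otimes1)(1\otimes1\otimes Z\otimes1)|\phi\rangle|\psi_{23}\rangle=(1\otimes Z\otimes1)|\psi\rangle$. **Theorem.** 1. $P_1$ reconstructs $P_0$ from the edge $12$ if and only if $\beta^i\alpha^0=\alpha^i$ and $[\beta^i,Z]\alpha^0=0$ for $i=0,1$; and from the edge $23$ if and only if $\tilde\beta^i\tilde\alpha^0=\tilde\alpha^i$ and $[\tilde\beta^i,Z]\tilde\alpha^0=0$ for $i=0,1$. 2. If $\alpha^0$ is invertible and some $P_1$ reconstructs $P_0$ from the edge $12$, then for every $p\in[0,1]$ for which $\rho(p)$ is purifiable to $|\psi\rangle$, $\rho_{12}(p)$ is purifiable to $|\phi\rangle$. Likewise for the edge $23$, with $\tilde\alpha^0$ and $\rho_{23}(p)$. If $\alpha^0$ and $\tilde\alpha^0$ are invertible and $P_0$ can be reconstructed from each of the two edges (by possibly different projectors), then the DRPP is optimal for $P_0$. 3. If $\alpha^0,\alpha^1$ are invertible, then $P_0$ can be reconstructed from the edge $12$ if and only if $\alpha^0(\alpha^1)^{-1}$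 is diagonal; if $\tilde\alpha^0,\tilde\alpha^1$ are invertible, then $P_0$ can be reconstructed from the edge $23$ if and only if $\tilde\alpha^0(\tilde\alpha^1)^{-1}$ is diagonal. If all four matrices are invertible, then reconstructibility from the edge $12$ and reconstructibility from the edge $23$ are each equivalent to: $\alpha_{0,11},\alpha_{1,11}\neq0$ and $$P_0=\begin{pmatrix}\frac{\alpha_{0,01}\alpha_{0,10}}{\alpha_{0,11}}&\alpha_{0,01}&\alpha_{0,10}&\alpha_{0,11}\\ \frac{\alpha_{1,01}\alpha_{1,10}}{\alpha_{1,11}}&\alpha_{1,01}&\alpha_{1,10}&\alpha_{1,11}\end{pmatrix}$$ (columns ordered $ik=00,01,10,11$). Conversely, every $P_0$ of this form with all $\alpha_{j,01},\alpha_{j,10},\alpha_{j,11}$ non-zero can be reconstructed from both edges, and if moreover $\alpha_{0,01}\alpha_{1,11}\ne\alpha_{1,01}\alpha_{0,11}$ and $\alpha_{0,10}\alpha_{1,11}\neq\alpha_{1,10}\alpha_{0,11}$, then the DRPP is optimal for $P_0$. 4. For real $\theta_1,\theta_2$, the member of this family with $\alpha_{0,01}=\alpha_{0,10}=\alpha_{0,11}=1$,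 $\alpha_{1,01}=e^{i\theta_1}$, $\alpha_{1,10}=e^{i\theta_2}$, $\alpha_{1,11}=e^{i(\theta_1+\theta_2)}$ has as its valence bond state $2\sqrt2$ times the weighted graph state obtained from $|+\rangle^{\otimes3}$ by controlled-phase gates of phase $\theta_2$ between qubits $1,2$ and $\theta_1$ between qubits $2,3$; for $\theta_1=\theta_2=\pi$ this weighted graph state is the cluster state, i.e. the graph state of the path on three vertices. If $e^{i\theta_1}\ne1\neq e^{i\theta_2}$, the DRPP is optimal for this member. Finally, some member of the family with all $\alpha_{j,01},\alpha_{j,10},\alpha_{j,11}$ non-zero has the DRPP optimal while its valence bond state is not equal, up to a scalar and local unitaries, to any three-qubit graph state. -/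

import Mathlib

open scoped Matrix

noncomputable section

namespace VBS

/-- (Unnormalised) pure states of qubits labelled by `ι`, in the computational basis. -/
abbrev Ket (ι : Type) : Type := (ι → Fin 2) → ℂ

/-- Operators on qubits labelled by `ι`. -/
abbrev Op (ι : Type) : Type := Matrix (ι → Fin 2) (ι → Fin 2) ℂ

/-- The rank-one operator `|ψ⟩⟨ψ|`. -/
def proj {ι : Type} (ψ : Ket ι) : Op ι := Matrix.vecMulVec ψ (star ψ)

/-- The fidelity `⟨ψ|σ|ψ⟩ / (tr σ ⟨ψ|ψ⟩)` of the normalisation of `σ` with that of `ψ`. -/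
def fidelity {ι : Type} [Fintype ι] [DecidableEq ι] (σ : Op ι) (ψ : Ket ι) : ℝ :=
  (star ψ ⬝ᵥ (σ *ᵥ ψ)).re / (σ.trace.re * (star ψ ⬝ᵥ ψ).re)

/-! ### Local operations, classical communication, postselection -/

/-- The tensor product of one local operator per party. -/
def localOp {ι : Type} [Fintype ι] {d e : ι → ℕ}
    (A : ∀ q, Matrix (Fin (e q)) (Fin (d q)) ℂ) :
    Matrix (∀ q, Fin (e q)) (∀ q, Fin (d q)) ℂ :=
  Matrix.of fun x y => ∏ q, A q (x q) (y q)

/-- A finite LOCC protocol with postselection (SLOCC), for parties `ι` with local dimensions `d`,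
ending with one qubit per party. In each round every party `q` performs a local generalised
measurement with `m q` outcomes and Kraus operators `K q a` (into a space of dimension `e q a`, so
that ancillas may be added or removed), all outcomes are announced, and the rest of the protocol
may depend on them. A branch ends by being accepted or rejected. -/
inductive SLOCC (ι : Type) : (ι → ℕ) → Type
  | accept : SLOCC ι (fun _ => 2)
  | reject (d : ι → ℕ) : SLOCC ι d
  | round {d : ι → ℕ} (m : ι → ℕ) (e : ∀ q, Fin (m q) → ℕ)
      (K : ∀ q, ∀ a : Fin (m q), Matrix (Fin (e q a)) (Fin (d q)) ℂ)
      (complete : ∀ q, ∑ a, (K q a)ᴴ * K q a = 1)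
      (next : ∀ a : (∀ q, Fin (m q)), SLOCC ι (fun q => e q (a q))) : SLOCC ι d

/-- The sum of the unnormalised output states over the accepted branches. Its trace is the success
probability (for a normalised input). -/
def SLOCC.run {ι : Type} [Fintype ι] [DecidableEq ι] {d : ι → ℕ} :
    SLOCC ι d → Matrix (∀ q, Fin (d q)) (∀ q, Fin (d q)) ℂ → Op ι
  | .accept, σ => σ
  | .reject _, _ => 0
  | .round _ _ K _ next, σ =>
      ∑ a, (next a).run (localOp (fun q => K q (a q)) * σ * (localOp (fun q => K q (a q)))ᴴ)

/-- `ρ^{⊗ n}`, where every party holds its qubit of each of the `n` copies in one register of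
dimension `2 ^ n`. -/
def copies {ι : Type} (n : ℕ) (ρ : Op ι) :
    Matrix (ι → Fin (2 ^ n)) (ι → Fin (2 ^ n)) ℂ :=
  Matrix.of fun x y =>
    ∏ c, ρ (fun q => finFunctionFinEquiv.symm (x q) c) (fun q => finFunctionFinEquiv.symm (y q) c)

/-- The operator `σ` has non-zero weight and, once normalised, fidelity at least `1 - ε`
with `ψ`. -/
def IsClose {ι : Type} [Fintype ι] [DecidableEq ι] (ε : ℝ) (σ : Op ι) (ψ : Ket ι) : Prop :=
  0 < σ.trace.re ∧ 1 - ε ≤ fidelity σ ψ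

/-- `ρ` can be purified to `ψ`: from sufficiently many copies of `ρ`, each qubit being held by a
different party, some SLOCC protocol succeeds with positive probability in producing `ψ` with
fidelity arbitrarily close to one. -/
def Purifiable {ι : Type} [Fintype ι] [DecidableEq ι] (ρ : Op ι) (ψ : Ket ι) : Prop :=
  ∀ ε : ℝ, 0 < ε → ∃ (n : ℕ) (S : SLOCC ι (fun _ => 2 ^ n)), IsClose ε (S.run (copies n ρ)) ψ

/-! ### Local `Z`-noise -/

/-- The Pauli matrix `Z`. -/
def pauliZ : Matrix (Fin 2) (Fin 2) ℂ := !![1, 0; 0, -1]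

/-- `Z` applied to all the qubits in `s`. -/
def zOn {ι : Type} [Fintype ι] [DecidableEq ι] (s : Finset ι) : Op ι :=
  Matrix.diagonal fun x => ∏ q ∈ s, (-1 : ℂ) ^ (x q : ℕ)

/-- Every qubit independently suffers a `Z`-error with probability `p`. -/
def zNoise {ι : Type} [Fintype ι] [DecidableEq ι] (p : ℝ) (ρ : Op ι) : Op ι :=
  ∑ s : Finset ι, ((p ^ s.card * (1 - p) ^ sᶜ.card : ℝ) : ℂ) • (zOn s * ρ * zOn s)

/-! ### The valence bond state on three sites with `D = d = 2` -/

/-- A map `P = ∑ α_{j,ik} |j⟩⟨i|⟨k|` from two qubits to one; `P j (i, k) = α_{j,ik}`. -/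
abbrev Projector : Type := Matrix (Fin 2) (Fin 2 × Fin 2) ℂ

/-- The matrix `α^k`, with `⟨j|α^k|i⟩ = α_{j,ik}`. -/
def slice (P : Projector) (k : Fin 2) : Matrix (Fin 2) (Fin 2) ℂ := Matrix.of fun j i => P j (i, k)

/-- The mirror image of `slice`, for the other edge: entries `(j, k) ↦ α_{j,ik}`. -/
def coslice (P : Projector) (i : Fin 2) : Matrix (Fin 2) (Fin 2) ℂ :=
  Matrix.of fun j k => P j (i, k)

/-- The (unnormalised) maximally entangled state `∑ i, |i⟩|i⟩`. -/
def bell : Ket (Fin 2) := fun x => if x 0 = x 1 then 1 else 0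

/-- Tensor product of two two-qubit kets. -/
def tensor (ξ η : Ket (Fin 2)) : Ket (Fin 4) := fun x => ξ ![x 0, x 1] * η ![x 2, x 3]

/-- Tensor product of two two-qubit operators. -/
def tensorOp (σ τ : Op (Fin 2)) : Op (Fin 4) :=
  Matrix.of fun x y => σ ![x 0, x 1] ![y 0, y 1] * τ ![x 2, x 3] ![y 2, y 3]

/-- `1 ⊗ P ⊗ 1`, with `P` acting on the two middle ones of four qubits. -/
def midOp (P : Projector) : Matrix (Fin 3 → Fin 2) (Fin 4 → Fin 2) ℂ :=
  Matrix.of fun x y => if y 0 = x 0 ∧ y 3 = x 2 then P (x 1) (y 1, y 2) else 0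

/-- The valence bond state `(1 ⊗ P ⊗ 1) |φ⟩|φ⟩`. -/
def vbs (P : Projector) : Ket (Fin 3) := midOp P *ᵥ tensor bell bell

/-- The state of the first two qubits after outcome `0` of a `Z`-measurement on the third. -/
def pair12 (P : Projector) : Ket (Fin 2) := fun x => vbs P ![x 0, x 1, 0]

/-- The state of the last two qubits after outcome `0` of a `Z`-measurement on the first. -/
def pair23 (P : Projector) : Ket (Fin 2) := fun x => vbs P ![0, x 0, x 1]

/-- `P₁` rebuilds the valence bond state of `P₀` from the pair of qubits `1, 2` and a locally
introduced maximally entangled pair, and carries a `Z`-error of the second qubit of the pair over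
to the second qubit of the valence bond state. -/
def Reconstructs12 (P₀ P₁ : Projector) : Prop :=
  midOp P₁ *ᵥ tensor (pair12 P₀) bell = vbs P₀ ∧
  midOp P₁ *ᵥ (zOn {1} *ᵥ tensor (pair12 P₀) bell) = zOn {1} *ᵥ vbs P₀

/-- The mirror image of `Reconstructs12`, for the pair of qubits `2, 3`. -/
def Reconstructs23 (P₀ P₁ : Projector) : Prop :=
  midOp P₁ *ᵥ tensor bell (pair23 P₀) = vbs P₀ ∧
  midOp P₁ *ᵥ (zOn {2} *ᵥ tensor bell (pair23 P₀)) = zOn {1} *ᵥ vbs P₀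

/-- The valence bond state after local `Z`-noise. -/
def noisy (P : Projector) (p : ℝ) : Op (Fin 3) := zNoise p (proj (vbs P))

/-- The noisy state of qubits `1, 2` after outcome `0` of a `Z`-measurement on qubit `3`. -/
def noisy12 (P : Projector) (p : ℝ) : Op (Fin 2) :=
  Matrix.of fun x y => noisy P p ![x 0, x 1, 0] ![y 0, y 1, 0]

/-- The noisy state of qubits `2, 3` after outcome `0` of a `Z`-measurement on qubit `1`. -/
def noisy23 (P : Projector) (p : ℝ) : Op (Fin 2) :=
  Matrix.of fun x y => noisy P p ![0, x 0, x 1] ![0, y 0, y 1]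

/-- The Divide and Rebuild Purification Protocol works at error probability `p`: the two-qubit
states left by the `Z`-measurements can be purified, by two-party SLOCC on each edge, to states
`σ`, `τ` arbitrarily close to the maximally entangled state, and applying the projector `P` at the
middle site then gives a state arbitrarily close to the valence bond state. -/
def DRPPPurifies (P : Projector) (p : ℝ) : Prop :=
  ∀ ε : ℝ, 0 < ε → ∃ (n m : ℕ) (S : SLOCC (Fin 2) (fun _ => 2 ^ n))
    (T : SLOCC (Fin 2) (fun _ => 2 ^ m)),
    IsClose ε (S.run (copies n (noisy12 P p))) bell ∧
    IsClose ε (T.run (copies m (noisy23 P p))) bell ∧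
    IsClose ε (midOp P * tensorOp (S.run (copies n (noisy12 P p)))
      (T.run (copies m (noisy23 P p))) * (midOp P)ᴴ) (vbs P)

/-- Optimality under local `Z`-noise: at every error probability at which any SLOCC protocol can
purify the noisy valence bond state, the divide and rebuild protocol does (and conversely). -/
def DRPPOptimal (P : Projector) : Prop :=
  ∀ p : ℝ, 0 ≤ p → p ≤ 1 → (Purifiable (noisy P p) (vbs P) ↔ DRPPPurifies P p)

/-! ### The explicit family, weighted graph states and graph states -/

/-- The projector with `α_{j,01} = a j`, `α_{j,10} = b j`, `α_{j,11} = c j` and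
`α_{j,00} = a j * b j / c j`. -/
def family (a b c : Fin 2 → ℂ) : Projector :=
  Matrix.of fun j ik => !![a j * b j / c j, a j; b j, c j] ik.1 ik.2

/-- The state `|+⟩|+⟩|+⟩`. -/
def plus : Ket (Fin 3) := fun _ => ((1 / √2 : ℝ) : ℂ) ^ 3

/-- The controlled-phase gate of phase `θ` between the qubits `u` and `v`. -/
def controlledPhase (u v : Fin 3) (θ : ℝ) : Op (Fin 3) :=
  Matrix.diagonal fun x => if x u = 1 ∧ x v = 1 then Complex.exp (θ * Complex.I) else 1

/-- The weighted graph state of the three-qubit chain, with phase `θ₂` on the edge between the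
first two qubits and phase `θ₁` on the other edge. -/
def weightedGraphState (θ₁ θ₂ : ℝ) : Ket (Fin 3) :=
  controlledPhase 0 1 θ₂ *ᵥ (controlledPhase 1 2 θ₁ *ᵥ plus)

open Classical in
/-- The graph state of a graph on three vertices: a controlled-`Z` gate along every edge, applied
to `|+⟩|+⟩|+⟩`. -/
def graphState (G : SimpleGraph (Fin 3)) : Ket (Fin 3) := fun x =>
  (∏ u, ∏ v, if u < v ∧ G.Adj u v ∧ x u = 1 ∧ x v = 1 then (-1 : ℂ) else 1) * plus x

/-- `ψ` is, up to a scalar and local unitaries, a graph state. -/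
def IsLocallyGraphState (ψ : Ket (Fin 3)) : Prop :=
  ∃ (G : SimpleGraph (Fin 3)) (U : Fin 3 → Matrix.unitaryGroup (Fin 2) ℂ) (z : ℂ),
    ψ = z • (localOp (d := fun _ => 2) (e := fun _ => 2)
      (fun q => (U q : Matrix (Fin 2) (Fin 2) ℂ)) *ᵥ graphState G)

/-- The weighted-graph-state member of the family. -/
def weightedProjector (θ₁ θ₂ : ℝ) : Projector :=
  family ![1, Complex.exp (θ₁ * Complex.I)] ![1, Complex.exp (θ₂ * Complex.I)]
    ![1, Complex.exp ((θ₁ + θ₂) * Complex.I)]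

end VBS

end

namespace VBS

open scoped ComplexOrder MatrixOrder

/-! If `α^0` is invertible, reconstructibility from the edge 12 means `α^k = D_k α^0` with `D_k`
diagonal (`exists_rescaling`), since a matrix commuting with `Z` is diagonal. In the computational
basis `Z`-noise only multiplies matrix entries, so such factors pass through it: `ρ(p)` arises from
`ρ₁₂(p)` by an operation of the second party alone, which creates the third qubit and inflicts a
random `Z`-error on it (`noisy_eq_sum`). One party can thus play sites 2 and 3 and imitate any
three-party protocol; projecting the third output on `0` and inverting `α^0` turns `|ψ⟩` into `|φ⟩`
(`purifiable_noisy12`). Reversing the chain gives the edge 23.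

Protocols are handled through their branches. A mixture is no closer to a ket than its best
component, so postselection reduces a protocol to one operator per party (`exists_isClose_distill`),
and every such tuple can be realised up to a factor (`purifiable_of_distill`). A linear map that
does not annihilate the target preserves closeness (`exists_isClose_conj`); hence purified edges
yield `|ψ⟩`. Conversely, divide and rebuild is itself a three-party protocol
(`distill_combinedOps`).

For `c j ≠ 0` the explicit family consists of the projectors whose matrices `(i, k) ↦ α_{j,ik}` are
singular for each `j`. This is symmetric in `i` and `k`, which is why the two edges give the same
criterion. The non-graph example rests on the reduced state of the first qubit, which for a graph
state is pure or maximally mixed. -/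

/-! ### Infidelity under a linear map -/

theorem norm_smul_sub_smul_sq {G : Type*} [NormedAddCommGroup G] [InnerProductSpace ℂ G] (a b : G)
    (c : ℂ) (n : ℝ) : ‖(n : ℂ) • b - c • a‖ ^ 2 = n ^ 2 * ‖b‖ ^ 2 + ‖c‖ ^ 2 * ‖a‖ ^ 2
      - 2 * n * (starRingEnd ℂ c * inner ℂ a b).re := by
  rw [@norm_sub_sq ℂ, inner_smul_left, inner_smul_right, norm_smul, norm_smul,
    ← inner_conj_symm b a]
  simp only [Complex.norm_real, Real.norm_eq_abs, mul_pow, sq_abs, RCLike.re_eq_complex_re,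
    Complex.mul_re, Complex.conj_re, Complex.conj_im, Complex.ofReal_re, Complex.ofReal_im,
    Complex.mul_im]
  ring

/-- An estimate behind the continuity of the fidelity under linear maps: for unnormalised
mixtures of vectors `v i`, nearness to `ψ` implies nearness of the image to `f ψ`. -/
theorem exists_infidelity_bound {E F : Type*} [NormedAddCommGroup E] [InnerProductSpace ℂ E]
    [NormedAddCommGroup F] [InnerProductSpace ℂ F] (f : E →L[ℂ] F) (ψ : E) (hψ : f ψ ≠ 0)
    {ε : ℝ} (hε : 0 < ε) :
    ∃ δ : ℝ, 0 < δ ∧ ∀ {ι : Type} [Fintype ι] (v : ι → E), 0 < ∑ i, ‖v i‖ ^ 2 →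
      (1 - δ) * ((∑ i, ‖v i‖ ^ 2) * ‖ψ‖ ^ 2) ≤ ∑ i, ‖inner ℂ ψ (v i)‖ ^ 2 →
      0 < ∑ i, ‖f (v i)‖ ^ 2 ∧
      (1 - ε) * ((∑ i, ‖f (v i)‖ ^ 2) * ‖f ψ‖ ^ 2) ≤ ∑ i, ‖inner ℂ (f ψ) (f (v i))‖ ^ 2 := by
  have hψ0 : ψ ≠ 0 := by rintro rfl; simp at hψ
  obtain ⟨C, hC0, hC⟩ : ∃ C : ℝ, 0 < C ∧ ∀ x, ‖f x‖ ^ 2 ≤ C * ‖x‖ ^ 2 := by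
    refine ⟨‖f‖ ^ 2 + 1, by positivity, fun x => ?_⟩
    have := f.le_opNorm x
    have h2 : ‖f x‖ ^ 2 ≤ (‖f‖ * ‖x‖) ^ 2 := by gcongr
    nlinarith [sq_nonneg ‖x‖]
  set N := ‖ψ‖ ^ 2 with hN
  set M := ‖f ψ‖ ^ 2 with hM
  have hN0 : 0 < N := by positivity
  have hM0 : 0 < M := by positivity
  -- `N • v - ⟨ψ, v⟩ • ψ` is `N` times the component of `v` orthogonal to `ψ`, so its norm measures
  -- the infidelity of `v`.
  have hD : ∀ v : E, ‖(N : ℂ) • v - (inner ℂ ψ v) • ψ‖ ^ 2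
      = N * (N * ‖v‖ ^ 2 - ‖inner ℂ ψ v‖ ^ 2) := by
    intro v
    rw [norm_smul_sub_smul_sq, ← Complex.normSq_eq_conj_mul_self, Complex.ofReal_re, Complex.normSq_eq_norm_sq]
    ring
  -- The Cauchy–Schwarz gap with `f ψ` ignores multiples of `f ψ`, so `N • f v` has the same gap as
  -- `f w`, which is at most `M * ‖f w‖ ^ 2`.
  have hgap : ∀ v : E, N * (M * ‖f v‖ ^ 2 - ‖inner ℂ (f ψ) (f v)‖ ^ 2)
      ≤ M * C * (N * ‖v‖ ^ 2 - ‖inner ℂ ψ v‖ ^ 2) := by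
    intro v
    set c := inner ℂ ψ v
    set w := (N : ℂ) • v - c • ψ with hw
    have h1 : f w = (N : ℂ) • f v - c • f ψ := by simp [hw]
    have h2 : inner ℂ (f ψ) (f w) = N * inner ℂ (f ψ) (f v) - c * (M : ℂ) := by
      rw [h1, inner_sub_right, inner_smul_right, inner_smul_right, inner_self_eq_norm_sq_to_K]
      simp [hM]
    have h3 : ‖inner ℂ (f ψ) (f w)‖ ^ 2 = N ^ 2 * ‖inner ℂ (f ψ) (f v)‖ ^ 2 + M ^ 2 * ‖c‖ ^ 2
        - 2 * N * M * (starRingEnd ℂ c * inner ℂ (f ψ) (f v)).re := by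
      rw [h2, ← Complex.normSq_eq_norm_sq, ← Complex.normSq_eq_norm_sq,
        ← Complex.normSq_eq_norm_sq]
      simp only [Complex.normSq_apply, Complex.sub_re, Complex.sub_im, Complex.mul_re,
        Complex.mul_im, Complex.ofReal_re, Complex.ofReal_im, Complex.conj_re, Complex.conj_im]
      ring
    have h4 : ‖f w‖ ^ 2 = N ^ 2 * ‖f v‖ ^ 2 + ‖c‖ ^ 2 * M
        - 2 * N * (starRingEnd ℂ c * inner ℂ (f ψ) (f v)).re := by rw [h1, norm_smul_sub_smul_sq]
    have h5 := hC w
    rw [hD] at h5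
    have h6 : N * (N * (M * ‖f v‖ ^ 2 - ‖inner ℂ (f ψ) (f v)‖ ^ 2))
        ≤ N * (M * C * (N * ‖v‖ ^ 2 - ‖c‖ ^ 2)) := by
      have h7 : N * (N * (M * ‖f v‖ ^ 2 - ‖inner ℂ (f ψ) (f v)‖ ^ 2))
          = M * ‖f w‖ ^ 2 - ‖inner ℂ (f ψ) (f w)‖ ^ 2 := by rw [h3, h4]; ring
      rw [h7]
      have := mul_le_mul_of_nonneg_left h5 hM0.le
      nlinarith [sq_nonneg ‖inner ℂ (f ψ) (f w)‖]
    exact le_of_mul_le_mul_left h6 hN0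
  -- A lower bound for the weight after `f`: if `v` is nearly parallel to `ψ`, then `f v` cannot be
  -- small.
  have hlow : ∀ v : E, M * ‖inner ℂ ψ v‖ ^ 2
      ≤ 2 * C * (N * (N * ‖v‖ ^ 2 - ‖inner ℂ ψ v‖ ^ 2)) + 2 * N ^ 2 * ‖f v‖ ^ 2 := by
    intro v
    have h1 := hC ((N : ℂ) • v - (inner ℂ ψ v) • ψ)
    rw [hD] at h1
    have h2 : ‖(inner ℂ ψ v : ℂ) • f ψ‖ ^ 2
        ≤ 2 * ‖f ((N : ℂ) • v - (inner ℂ ψ v) • ψ)‖ ^ 2 + 2 * ‖(N : ℂ) • f v‖ ^ 2 := by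
      have h3 : (inner ℂ ψ v : ℂ) • f ψ = (N : ℂ) • f v
          - f ((N : ℂ) • v - (inner ℂ ψ v) • ψ) := by simp
      rw [h3]
      have := norm_sub_le ((N : ℂ) • f v) (f ((N : ℂ) • v - (inner ℂ ψ v) • ψ))
      have h4 := pow_le_pow_left₀ (norm_nonneg _) this 2
      nlinarith [sq_nonneg (‖(N : ℂ) • f v‖ - ‖f ((N : ℂ) • v - (inner ℂ ψ v) • ψ)‖)]
    rw [norm_smul, norm_smul, mul_pow, mul_pow] at h2
    simp only [Complex.norm_real, Real.norm_eq_abs, sq_abs] at h2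
    nlinarith
  -- The first bound keeps the output weight `T'` above `M * T / (4 * N)`; the second makes the
  -- output gap at most the fraction `ε` of `M * T'`.
  set δ := min (M / (2 * (M + 2 * C * N))) (ε * M / (4 * C * N)) with hδ
  have hδ1 : δ * (M + 2 * C * N) ≤ M / 2 := by
    have : δ ≤ M / (2 * (M + 2 * C * N)) := min_le_left _ _
    rw [le_div_iff₀ (by positivity)] at this
    linarith
  have hδ2 : δ * (4 * C * N) ≤ ε * M := by
    have : δ ≤ ε * M / (4 * C * N) := min_le_right _ _
    rwa [le_div_iff₀ (by positivity)] at this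
  refine ⟨δ, by positivity, fun {ι} _ v hT hF => ?_⟩
  have hgap' := Finset.sum_le_sum fun i (_ : i ∈ Finset.univ) => hgap (v i)
  have hlow' := Finset.sum_le_sum fun i (_ : i ∈ Finset.univ) => hlow (v i)
  simp only [Finset.sum_add_distrib, Finset.sum_sub_distrib, ← Finset.mul_sum] at hgap' hlow'
  set T := ∑ i, ‖v i‖ ^ 2
  set S := ∑ i, ‖inner ℂ ψ (v i)‖ ^ 2
  set T' := ∑ i, ‖f (v i)‖ ^ 2
  set S' := ∑ i, ‖inner ℂ (f ψ) (f (v i))‖ ^ 2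
  have hdef : N * T - S ≤ δ * (N * T) := by linarith
  have hT' : M * T / 4 ≤ N * T' := by
    have h1 : (M + 2 * C * N) * (N * T - S) ≤ M / 2 * (N * T) := by
      calc _ ≤ (M + 2 * C * N) * (δ * (N * T)) := by gcongr
        _ = δ * (M + 2 * C * N) * (N * T) := by ring
        _ ≤ _ := by gcongr
    have h2 : N * (M * T / 4) ≤ N * (N * T') := by nlinarith
    exact le_of_mul_le_mul_left h2 hN0
  have hpos : 0 < T' := by
    have : 0 < N * T' := lt_of_lt_of_le (by positivity) hT'
    exact pos_of_mul_pos_right this hN0.le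
  refine ⟨hpos, ?_⟩
  have h1 : N * (M * T' - S') ≤ N * (ε * (M * T')) := by
    calc _ ≤ M * C * (N * T - S) := hgap'
      _ ≤ M * C * (δ * (N * T)) := by gcongr
      _ = M * T / 4 * (δ * (4 * C * N)) := by ring
      _ ≤ M * T / 4 * (ε * M) := by gcongr
      _ ≤ N * T' * (ε * M) := by gcongr
      _ = _ := by ring
  have := le_of_mul_le_mul_left h1 hN0
  linarith

/-! ### Fidelity -/

/-- The columns of `B` form an unnormalised ensemble for `σ`, which is the form of mixture treated
in `exists_infidelity_bound`. -/
theorem exists_eq_mul_conjTranspose {n : Type*} [Fintype n] [DecidableEq n] {σ : Matrix n n ℂ}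
    (h : σ.PosSemidef) : ∃ B : Matrix n n ℂ, σ = B * Bᴴ := by
  obtain ⟨B, hB⟩ := CStarAlgebra.nonneg_iff_eq_star_mul_self.mp h.nonneg
  exact ⟨Bᴴ, by rw [hB, Matrix.conjTranspose_conjTranspose, Matrix.star_eq_conjTranspose]⟩

theorem trace_mul_conjTranspose_re {n m : Type*} [Fintype n] [Fintype m] (B : Matrix n m ℂ) :
    (B * Bᴴ).trace.re = ∑ i, ‖WithLp.toLp 2 (B.col i)‖ ^ 2 := by
  simp only [EuclideanSpace.norm_sq_eq, Matrix.trace, Matrix.diag, Matrix.mul_apply,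
    Matrix.conjTranspose_apply, Complex.re_sum, Matrix.col_apply]
  rw [Finset.sum_comm]
  refine Finset.sum_congr rfl fun i _ => Finset.sum_congr rfl fun j _ => ?_
  rw [Complex.star_def, Complex.mul_conj, Complex.ofReal_re, Complex.normSq_eq_norm_sq]

theorem star_dotProduct_self_re {n : Type*} [Fintype n] (ψ : n → ℂ) :
    (star ψ ⬝ᵥ ψ).re = ‖WithLp.toLp 2 ψ‖ ^ 2 := by
  simp only [EuclideanSpace.norm_sq_eq, dotProduct, Complex.re_sum]
  refine Finset.sum_congr rfl fun j _ => ?_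
  rw [Pi.star_apply, Complex.star_def, mul_comm, Complex.mul_conj, Complex.ofReal_re,
    Complex.normSq_eq_norm_sq]

theorem star_dotProduct_mul_conjTranspose_re {n m : Type*} [Fintype n] [Fintype m]
    (B : Matrix n m ℂ) (ψ : n → ℂ) : (star ψ ⬝ᵥ ((B * Bᴴ) *ᵥ ψ)).re =
      ∑ i, ‖inner ℂ (WithLp.toLp 2 ψ) (WithLp.toLp 2 (B.col i))‖ ^ 2 := by
  have h1 : star ψ ⬝ᵥ ((B * Bᴴ) *ᵥ ψ) = (star (Bᴴ *ᵥ ψ)) ⬝ᵥ (Bᴴ *ᵥ ψ) := by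
    rw [← Matrix.mulVec_mulVec, Matrix.dotProduct_mulVec, Matrix.star_mulVec,
      Matrix.conjTranspose_conjTranspose]
  rw [h1, star_dotProduct_self_re, EuclideanSpace.norm_sq_eq]
  refine Finset.sum_congr rfl fun i _ => ?_
  rw [EuclideanSpace.inner_eq_star_dotProduct, ← norm_star]
  congr 2
  simp [Matrix.mulVec, dotProduct, mul_comm]

section IsClose

variable {ι κ : Type} [Fintype ι] [DecidableEq ι] [Fintype κ] [DecidableEq κ]

theorem star_dotProduct_self_re_pos {n : Type*} [Fintype n] {ψ : n → ℂ} (hψ : ψ ≠ 0) :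
    0 < (star ψ ⬝ᵥ ψ).re := by
  rw [star_dotProduct_self_re]
  have : WithLp.toLp 2 ψ ≠ 0 := by simpa using hψ
  positivity

/-- Clearing the denominator makes both sides linear in `σ`, so that branches can be summed. -/
theorem isClose_iff {ε : ℝ} {σ : Op ι} {ψ : Ket ι} (hψ : ψ ≠ 0) :
    IsClose ε σ ψ ↔ 0 < σ.trace.re ∧
      (1 - ε) * (σ.trace.re * (star ψ ⬝ᵥ ψ).re) ≤ (star ψ ⬝ᵥ (σ *ᵥ ψ)).re := by
  refine and_congr_right fun h => ?_
  rw [fidelity, le_div_iff₀ (mul_pos h (star_dotProduct_self_re_pos hψ))]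

theorem IsClose.mono {ε δ : ℝ} {σ : Op ι} {ψ : Ket ι} (h : IsClose δ σ ψ) (hδ : δ ≤ ε) :
    IsClose ε σ ψ := ⟨h.1, by linarith [h.2]⟩

theorem isClose_smul_iff {ε c : ℝ} (hc : 0 < c) {σ : Op ι} {ψ : Ket ι} :
    IsClose ε ((c : ℂ) • σ) ψ ↔ IsClose ε σ ψ := by
  have h1 : ((c : ℂ) • σ).trace.re = c * σ.trace.re := by simp [Matrix.trace_smul]
  have h2 : (star ψ ⬝ᵥ (((c : ℂ) • σ) *ᵥ ψ)).re = c * (star ψ ⬝ᵥ (σ *ᵥ ψ)).re := by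
    simp [Matrix.smul_mulVec, dotProduct_smul]
  rw [IsClose, IsClose, fidelity, fidelity, h1, h2, mul_assoc, mul_div_mul_left _ _ hc.ne',
    mul_pos_iff_of_pos_left hc]

/-- The fidelity of a mixture is at most that of its best component. -/
theorem exists_isClose_of_sum {α : Type*} [Fintype α] {ε : ℝ} {X : α → Op ι} {ψ : Ket ι}
    (hψ : ψ ≠ 0) (hX : ∀ a, (X a).PosSemidef) (h : IsClose ε (∑ a, X a) ψ) :
    ∃ a, IsClose ε (X a) ψ := by
  by_contra! hcon
  simp only [isClose_iff hψ, not_and, not_le] at hcon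
  rw [isClose_iff hψ] at h
  simp only [Matrix.trace_sum, Matrix.sum_mulVec, dotProduct_sum, Complex.re_sum] at h
  obtain ⟨h0, h1⟩ := h
  obtain ⟨b, -, hb⟩ := Finset.exists_lt_of_sum_lt (s := Finset.univ) (f := fun _ : α => (0 : ℝ))
    (by simpa using h0)
  refine absurd h1 (not_le.mpr ?_)
  rw [Finset.sum_mul, Finset.mul_sum]
  refine Finset.sum_lt_sum (fun a _ => ?_) ⟨b, Finset.mem_univ _, hcon b hb⟩
  have hnn := (hX a).trace_nonneg
  -- A positive semidefinite component of trace zero vanishes and contributes nothing to either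
  -- side.
  rcases (Complex.nonneg_iff.mp hnn).1.eq_or_lt with ha | ha
  · have : (X a).trace = 0 := Complex.ext ha.symm (Complex.nonneg_iff.mp hnn).2.symm
    rw [(hX a).trace_eq_zero_iff] at this
    simp [this]
  · exact (hcon a ha).le

/-- Linear maps preserve nearness to a ket that they do not annihilate. -/
theorem exists_isClose_conj (K : Matrix (κ → Fin 2) (ι → Fin 2) ℂ) {ψ : Ket ι}
    (hψ : K *ᵥ ψ ≠ 0) {ε : ℝ} (hε : 0 < ε) :
    ∃ δ : ℝ, 0 < δ ∧ ∀ σ : Op ι, σ.PosSemidef → IsClose δ σ ψ →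
      IsClose ε (K * σ * Kᴴ) (K *ᵥ ψ) := by
  have hψ0 : ψ ≠ 0 := by rintro rfl; simp at hψ
  let f : EuclideanSpace ℂ (ι → Fin 2) →L[ℂ] EuclideanSpace ℂ (κ → Fin 2) :=
    (Matrix.toEuclideanLin K).toContinuousLinearMap
  have hf : ∀ v, f (WithLp.toLp 2 v) = WithLp.toLp 2 (K *ᵥ v) := fun v => rfl
  obtain ⟨δ, hδ, H⟩ := exists_infidelity_bound f (WithLp.toLp 2 ψ)
    (by rw [hf]; simpa using hψ) hε
  refine ⟨δ, hδ, fun σ hσ hcl => ?_⟩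
  obtain ⟨B, rfl⟩ := exists_eq_mul_conjTranspose hσ
  rw [isClose_iff hψ0, trace_mul_conjTranspose_re, star_dotProduct_mul_conjTranspose_re,
    star_dotProduct_self_re] at hcl
  have hKB : K * (B * Bᴴ) * Kᴴ = (K * B) * (K * B)ᴴ := by
    rw [Matrix.conjTranspose_mul]; simp only [Matrix.mul_assoc]
  have hcol : ∀ i, (K * B).col i = K *ᵥ B.col i := fun i => rfl
  rw [isClose_iff hψ, hKB, trace_mul_conjTranspose_re, star_dotProduct_mul_conjTranspose_re,
    star_dotProduct_self_re]
  simpa only [hf, hcol] using H (fun i => WithLp.toLp 2 (B.col i)) hcl.1 hcl.2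

end IsClose

/-! ### Reduction of SLOCC to a single local operator -/

section Local

variable {ι : Type} [Fintype ι]

theorem localOp_mul [DecidableEq ι] {d e f : ι → ℕ} (A : ∀ q, Matrix (Fin (f q)) (Fin (e q)) ℂ)
    (B : ∀ q, Matrix (Fin (e q)) (Fin (d q)) ℂ) :
    localOp A * localOp B = localOp fun q => A q * B q := by
  ext x y
  simp only [localOp, Matrix.mul_apply, Matrix.of_apply, ← Finset.prod_mul_distrib]
  rw [Finset.prod_univ_sum, Fintype.piFinset_univ]

theorem localOp_one {d : ι → ℕ} :
    localOp (fun q => (1 : Matrix (Fin (d q)) (Fin (d q)) ℂ)) = 1 := by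
  ext x y
  simp only [localOp, Matrix.of_apply, Matrix.one_apply, Finset.prod_ite_zero, funext_iff,
    Finset.mem_univ, true_imp_iff, Finset.prod_const_one]

theorem localOp_smul {d e : ι → ℕ} (c : ι → ℂ) (A : ∀ q, Matrix (Fin (e q)) (Fin (d q)) ℂ) :
    localOp (fun q => c q • A q) = (∏ q, c q) • localOp A := by
  ext x y
  simp [localOp, Finset.prod_mul_distrib]

variable [DecidableEq ι]

theorem SLOCC.run_posSemidef {d : ι → ℕ} (S : SLOCC ι d)
    {σ : Matrix (∀ q, Fin (d q)) (∀ q, Fin (d q)) ℂ} (hσ : σ.PosSemidef) :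
    (S.run σ).PosSemidef := by
  induction S with
  | accept => exact hσ
  | reject d => exact Matrix.PosSemidef.zero
  | round m e K complete next ih =>
    exact Matrix.posSemidef_sum _ fun a _ => ih a (hσ.mul_mul_conjTranspose_same _)

/-- Some branch of a protocol is at least as good as the whole protocol. -/
theorem SLOCC.exists_localOp_isClose {d : ι → ℕ} (S : SLOCC ι d) {ε : ℝ} {ψ : Ket ι}
    (hψ : ψ ≠ 0) {σ : Matrix (∀ q, Fin (d q)) (∀ q, Fin (d q)) ℂ} (hσ : σ.PosSemidef)
    (h : IsClose ε (S.run σ) ψ) :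
    ∃ A : ∀ q, Matrix (Fin 2) (Fin (d q)) ℂ,
      IsClose ε (localOp (e := fun _ => 2) A * σ * (localOp (e := fun _ => 2) A)ᴴ) ψ := by
  induction S with
  | accept =>
    refine ⟨fun _ => 1, ?_⟩
    rw [localOp_one]
    simpa [SLOCC.run] using h
  | reject d => simpa [SLOCC.run] using h.1
  | round m e K complete next ih =>
    -- The best outcome tuple suffices; its Kraus operators are composed with the local operators
    -- found for the remaining protocol.
    obtain ⟨a, ha⟩ := exists_isClose_of_sum hψ
      (fun a => (next a).run_posSemidef (hσ.mul_mul_conjTranspose_same _)) h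
    obtain ⟨A, hA⟩ := ih a (hσ.mul_mul_conjTranspose_same _) ha
    refine ⟨fun q => A q * K q (a q), ?_⟩
    rw [← localOp_mul, Matrix.conjTranspose_mul]
    simpa only [Matrix.mul_assoc] using hA

open scoped Matrix.Norms.L2Operator in
-- Scaled down to a contraction, `A` becomes a Kraus operator, and a square root of the positive
-- remainder completes the measurement.
theorem exists_contraction_complement {m n : Type*} [Fintype m] [Fintype n] [DecidableEq n]
    (A : Matrix m n ℂ) :
    ∃ c : ℝ, 0 < c ∧ ∃ B : Matrix n n ℂ,
      ((c : ℂ) • A)ᴴ * ((c : ℂ) • A) + Bᴴ * B = 1 := by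
  set M := Aᴴ * A with hM
  have hle : M ≤ algebraMap ℝ _ ‖M‖ :=
    IsSelfAdjoint.le_algebraMap_norm_self (Matrix.isHermitian_conjTranspose_mul_self A)
  set t : ℝ := 1 / (‖M‖ + 1) with ht'
  have ht : 0 < t := by positivity
  have h1 : t ^ 2 * ‖M‖ ≤ 1 := by
    have h2 : t * (‖M‖ + 1) ≤ 1 := (le_div_iff₀ (by positivity)).mp ht'.le
    have h3 : t ≤ 1 := by nlinarith [norm_nonneg M]
    nlinarith [norm_nonneg M, mul_nonneg ht.le (norm_nonneg M)]
  have h2 : (1 - ((t ^ 2 : ℝ) : ℂ) • M).PosSemidef := by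
    have h3 : (1 : Matrix n n ℂ) - ((t ^ 2 : ℝ) : ℂ) • M
        = ((t ^ 2 : ℝ) : ℂ) • (algebraMap ℝ (Matrix n n ℂ) ‖M‖ - M)
          + ((1 - t ^ 2 * ‖M‖ : ℝ) : ℂ) • 1 := by
      rw [Algebra.algebraMap_eq_smul_one, smul_sub, Complex.coe_smul, Complex.coe_smul,
        Complex.coe_smul, sub_smul, one_smul, smul_smul]
      abel
    rw [h3]
    refine Matrix.PosSemidef.add (Matrix.PosSemidef.smul hle ?_)
      (Matrix.PosSemidef.smul Matrix.PosSemidef.one ?_)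
    · exact_mod_cast sq_nonneg t
    · exact_mod_cast sub_nonneg.mpr h1
  obtain ⟨B, hB⟩ := exists_eq_mul_conjTranspose h2
  refine ⟨t, ht, Bᴴ, ?_⟩
  rw [Matrix.conjTranspose_conjTranspose, ← hB, Matrix.conjTranspose_smul, Matrix.smul_mul,
    Matrix.mul_smul, smul_smul, ← hM]
  simp [sq]

/-- Every local operator can be realised, up to a positive factor, by a protocol. -/
theorem exists_slocc_of_localOp {d : ι → ℕ} (A : ∀ q, Matrix (Fin 2) (Fin (d q)) ℂ) :
    ∃ (S : SLOCC ι d) (c : ℝ), 0 < c ∧ ∀ σ, S.run σ =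
      (c : ℂ) • (localOp (e := fun _ => 2) A * σ * (localOp (e := fun _ => 2) A)ᴴ) := by
  choose c hc B hB using fun q => exists_contraction_complement (A q)
  -- Outcome `0` applies the scaled `A q`. Each row of `B q` gives a further rank-one outcome ending
  -- in `|0⟩`; their Gram matrices sum to `(B q)ᴴ * B q`, and every outcome lands in one qubit.
  let K : ∀ q, Fin (d q + 1) → Matrix (Fin 2) (Fin (d q)) ℂ := fun q =>
    Fin.cons ((c q : ℂ) • A q)
      fun i => Matrix.vecMulVec (Pi.single 0 1) (B q i)
  have hK : ∀ q, ∑ a, (K q a)ᴴ * K q a = 1 := by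
    intro q
    rw [Fin.sum_univ_succ, ← hB q]
    simp only [K, Fin.cons_zero, Fin.cons_succ]
    congr 1
    ext x y
    simp [Matrix.sum_apply, Matrix.mul_apply, Matrix.vecMulVec_apply]
  let next : (∀ q, Fin (d q + 1)) → SLOCC ι (fun _ => 2) := fun a =>
    open Classical in if a = fun _ => 0 then .accept else .reject _
  refine ⟨.round (fun q => d q + 1) (fun _ _ => 2) K hK next, (∏ q, c q) ^ 2,
    pow_pos (Finset.prod_pos fun q _ => hc q) 2, fun σ => ?_⟩
  rw [SLOCC.run, Finset.sum_eq_single (fun _ => 0)]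
  · have h0 : (fun q => K q 0) = fun q => (c q : ℂ) • A q := rfl
    have h1 : next (fun _ => 0) = .accept := if_pos rfl
    have h2 : localOp (e := fun _ => 2) (fun q => (c q : ℂ) • A q)
        = (∏ q, (c q : ℂ)) • localOp (e := fun _ => 2) A := localOp_smul _ _
    rw [h1, SLOCC.run, h0, h2, Matrix.conjTranspose_smul, Matrix.smul_mul, Matrix.smul_mul,
      Matrix.mul_smul, smul_smul]
    congr 1
    simp [sq]
  · intro a _ ha
    have h1 : next a = .reject _ := if_neg ha
    rw [h1, SLOCC.run]
  · simp

end Local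

/-! ### Copies of a state, indexed by an arbitrary finite type -/

section Copies

variable {ι κ μ : Type}

/-- The tensor power of `M` over the index set `γ` of copies, with the copies of each qubit
collected at its party. -/
def tensorPower (γ : Type) [Fintype γ] (M : Matrix (ι → Fin 2) (κ → Fin 2) ℂ) :
    Matrix (ι → γ → Fin 2) (κ → γ → Fin 2) ℂ :=
  Matrix.of fun x y => ∏ c, M (fun q => x q c) (fun q => y q c)

theorem tensorPower_mul (γ : Type) [Fintype γ] [Fintype κ] [DecidableEq γ] [DecidableEq κ]
    (M : Matrix (ι → Fin 2) (κ → Fin 2) ℂ) (N : Matrix (κ → Fin 2) (μ → Fin 2) ℂ) :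
    tensorPower γ (M * N) = tensorPower γ M * tensorPower γ N := by
  ext x y
  simp only [tensorPower, Matrix.mul_apply, Matrix.of_apply, ← Finset.prod_mul_distrib]
  rw [Finset.prod_univ_sum, Fintype.piFinset_univ]
  -- Expanding the product over copies gives intermediate indices grouped by copy; the matrix
  -- product groups them by party.
  exact (Equiv.piComm fun (_ : κ) (_ : γ) => Fin 2).symm.sum_comp
    (fun z : κ → γ → Fin 2 => ∏ c, M (fun q => x q c) (fun q => z q c) *
      N (fun q => z q c) (fun q => y q c)) |>.symm ▸ rfl

theorem tensorPower_conjTranspose (γ : Type) [Fintype γ]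
    (M : Matrix (ι → Fin 2) (κ → Fin 2) ℂ) :
    tensorPower γ Mᴴ = (tensorPower γ M)ᴴ := by
  ext x y
  simp [tensorPower]

/-- An arbitrary index type lets copies used for different edges be joined as `γ ⊕ δ`, without
splitting registers of dimension `2 ^ (n + m)`. -/
theorem copies_eq_submatrix {γ : Type} [Fintype γ] {n : ℕ} (e : γ ≃ Fin n) (ρ : Op ι) :
    copies n ρ = (tensorPower γ ρ).submatrix
      (Equiv.piCongrRight fun _ => finFunctionFinEquiv.symm.trans (e.symm.arrowCongr (.refl _)))
      (Equiv.piCongrRight fun _ =>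
        finFunctionFinEquiv.symm.trans (e.symm.arrowCongr (.refl _))) := by
  ext x y
  simp only [copies, tensorPower, Matrix.of_apply, Matrix.submatrix_apply]
  exact (e.prod_comp _).symm

variable [Fintype ι]

/-- The tensor product of one local operator per party, from `γ` qubits to one qubit. -/
def localQubitOp {γ : Type} (A : ι → Matrix (Fin 2) (γ → Fin 2) ℂ) :
    Matrix (ι → Fin 2) (ι → γ → Fin 2) ℂ :=
  Matrix.of fun x y => ∏ q, A q (x q) (y q)

variable [DecidableEq ι]

theorem tensorPower_posSemidef (γ : Type) [Fintype γ] [DecidableEq γ] {ρ : Op ι}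
    (hρ : ρ.PosSemidef) : (tensorPower γ ρ).PosSemidef := by
  obtain ⟨B, rfl⟩ := exists_eq_mul_conjTranspose hρ
  rw [tensorPower_mul, tensorPower_conjTranspose]
  exact Matrix.posSemidef_self_mul_conjTranspose _

/-- The unnormalised output of local operators `A` on copies of `ρ`. -/
def distill {γ : Type} [Fintype γ] [DecidableEq γ] (A : ι → Matrix (Fin 2) (γ → Fin 2) ℂ)
    (ρ : Op ι) : Op ι :=
  localQubitOp A * tensorPower γ ρ * (localQubitOp A)ᴴ

theorem distill_posSemidef {γ : Type} [Fintype γ] [DecidableEq γ]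
    (A : ι → Matrix (Fin 2) (γ → Fin 2) ℂ) {ρ : Op ι} (hρ : ρ.PosSemidef) :
    (distill A ρ).PosSemidef :=
  (tensorPower_posSemidef γ hρ).mul_mul_conjTranspose_same _

theorem localOp_conj_copies {γ : Type} [Fintype γ] [DecidableEq γ] {n : ℕ} (e : γ ≃ Fin n)
    (A : ι → Matrix (Fin 2) (γ → Fin 2) ℂ) (A' : ι → Matrix (Fin 2) (Fin (2 ^ n)) ℂ)
    (h : ∀ q, A' q = (A q).submatrix id
      (finFunctionFinEquiv.symm.trans (e.symm.arrowCongr (.refl _)))) (ρ : Op ι) :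
    localOp (d := fun _ => 2 ^ n) (e := fun _ => 2) A' * copies n ρ *
      (localOp (d := fun _ => 2 ^ n) (e := fun _ => 2) A')ᴴ = distill A ρ := by
  have h1 : localOp (d := fun _ => 2 ^ n) (e := fun _ => 2) A' =
      (localQubitOp A).submatrix id (Equiv.piCongrRight fun _ =>
        finFunctionFinEquiv.symm.trans (e.symm.arrowCongr (.refl _))) := by
    ext x y
    simp only [localOp, localQubitOp, Matrix.of_apply, h]
    rfl
  rw [h1, copies_eq_submatrix e, Matrix.conjTranspose_submatrix, Matrix.submatrix_mul_equiv,
    Matrix.submatrix_mul_equiv]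
  rfl

theorem copies_posSemidef (n : ℕ) {ρ : Op ι} (hρ : ρ.PosSemidef) : (copies n ρ).PosSemidef := by
  rw [copies_eq_submatrix (.refl _)]
  exact (tensorPower_posSemidef _ hρ).submatrix _

theorem exists_isClose_distill {n : ℕ} (S : SLOCC ι fun _ => 2 ^ n) {ε : ℝ} {ψ : Ket ι}
    (hψ : ψ ≠ 0) {ρ : Op ι} (hρ : ρ.PosSemidef) (h : IsClose ε (S.run (copies n ρ)) ψ) :
    ∃ A : ι → Matrix (Fin 2) (Fin n → Fin 2) ℂ, IsClose ε (distill A ρ) ψ := by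
  obtain ⟨A, hA⟩ := S.exists_localOp_isClose hψ (copies_posSemidef n hρ) h
  refine ⟨fun q => (A q).submatrix id
    (finFunctionFinEquiv.symm.trans ((Equiv.refl _).symm.arrowCongr (.refl _))).symm, ?_⟩
  rwa [← localOp_conj_copies (.refl _) _ A (fun q => by simp)]

theorem purifiable_of_distill {ρ : Op ι} {ψ : Ket ι}
    (h : ∀ ε : ℝ, 0 < ε → ∃ (γ : Type) (_ : Fintype γ) (_ : DecidableEq γ)
      (A : ι → Matrix (Fin 2) (γ → Fin 2) ℂ), IsClose ε (distill A ρ) ψ) :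
    Purifiable ρ ψ := by
  intro ε hε
  obtain ⟨γ, _, _, A, hA⟩ := h ε hε
  obtain ⟨S, c, hc, hS⟩ := exists_slocc_of_localOp (d := fun _ => 2 ^ Fintype.card γ)
    fun q => (A q).submatrix id
      (finFunctionFinEquiv.symm.trans ((Fintype.equivFin γ).symm.arrowCongr (.refl _)))
  refine ⟨_, S, ?_⟩
  rw [hS, isClose_smul_iff hc, localOp_conj_copies (Fintype.equivFin γ) A _ fun q => rfl]
  exact hA

end Copies

/-! ### Relabelling the parties -/

section Relabel

variable {ι κ : Type} [Fintype ι] [DecidableEq ι] [Fintype κ] [DecidableEq κ]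

theorem isClose_submatrix_iff (e : (ι → Fin 2) ≃ (κ → Fin 2)) {ε : ℝ} {σ : Op κ} {ψ : Ket κ} :
    IsClose ε (σ.submatrix e e) (ψ ∘ e) ↔ IsClose ε σ ψ := by
  have h1 : (σ.submatrix e e).trace = σ.trace := by
    simp only [Matrix.trace, Matrix.diag, Matrix.submatrix_apply]
    exact e.sum_comp fun x => σ x x
  have h2 : star (ψ ∘ e) ⬝ᵥ (ψ ∘ e) = star ψ ⬝ᵥ ψ := by
    simp only [dotProduct, Pi.star_apply, Function.comp]
    exact e.sum_comp fun x => star (ψ x) * ψ x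
  have h3 : star (ψ ∘ e) ⬝ᵥ (σ.submatrix e e *ᵥ (ψ ∘ e)) = star ψ ⬝ᵥ (σ *ᵥ ψ) := by
    rw [Matrix.submatrix_mulVec_equiv, Function.comp_assoc, Equiv.self_comp_symm,
      Function.comp_id]
    exact e.sum_comp fun x => star (ψ x) * (σ *ᵥ ψ) x
  rw [IsClose, IsClose, fidelity, fidelity, h1, h2, h3]

/-- Relabelling of the qubits. -/
def relabel (e : κ ≃ ι) (α : Type) : (ι → α) ≃ (κ → α) := e.symm.arrowCongr (.refl α)

theorem distill_relabel (e : κ ≃ ι) {γ : Type} [Fintype γ] [DecidableEq γ]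
    (A : κ → Matrix (Fin 2) (γ → Fin 2) ℂ) (ρ : Op κ) :
    distill (fun q => A (e.symm q)) (ρ.submatrix (relabel e _) (relabel e _)) =
      (distill A ρ).submatrix (relabel e _) (relabel e _) := by
  have h1 : localQubitOp (fun q => A (e.symm q)) =
      (localQubitOp A).submatrix (relabel e _) (relabel e _) := by
    ext x y
    simp only [localQubitOp, Matrix.of_apply, Matrix.submatrix_apply]
    rw [← e.prod_comp]
    simp [relabel]
  have h2 : tensorPower γ (ρ.submatrix (relabel e _) (relabel e _)) =
      (tensorPower γ ρ).submatrix (relabel e _) (relabel e _) := rfl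
  rw [distill, distill, h1, h2, Matrix.conjTranspose_submatrix, Matrix.submatrix_mul_equiv,
    Matrix.submatrix_mul_equiv]

theorem Purifiable.relabel (e : κ ≃ ι) {ρ : Op κ} {ψ : Ket κ} (hψ : ψ ≠ 0)
    (hρ : ρ.PosSemidef) (h : Purifiable ρ ψ) :
    Purifiable (ρ.submatrix (relabel e _) (relabel e _)) (ψ ∘ VBS.relabel e _) := by
  refine purifiable_of_distill fun ε hε => ?_
  obtain ⟨n, S, hS⟩ := h ε hε
  obtain ⟨A, hA⟩ := exists_isClose_distill S hψ hρ hS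
  refine ⟨Fin n, inferInstance, inferInstance, fun q => A (e.symm q), ?_⟩
  rw [distill_relabel]
  exact (isClose_submatrix_iff _).mpr hA

end Relabel

/-! ### Sums over few qubits -/

theorem sum_fin_two_arrow {α M : Type*} [Fintype α] [AddCommMonoid M] (f : (Fin 2 → α) → M) :
    ∑ x, f x = ∑ a, ∑ b, f ![a, b] := by
  rw [← (finTwoArrowEquiv α).symm.sum_comp, Fintype.sum_prod_type]
  rfl

theorem sum_fin_succ_arrow {n : ℕ} {α M : Type*} [Fintype α] [AddCommMonoid M]
    (f : (Fin (n + 1) → α) → M) :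
    ∑ x, f x = ∑ a, ∑ y : Fin n → α, f (Matrix.vecCons a y) := by
  rw [← (Fin.consEquiv fun _ : Fin (n + 1) => α).sum_comp, Fintype.sum_prod_type]
  rfl

theorem sum_fin_three_arrow {α M : Type*} [Fintype α] [AddCommMonoid M]
    (f : (Fin 3 → α) → M) : ∑ x, f x = ∑ a, ∑ b, ∑ c, f ![a, b, c] := by
  rw [sum_fin_succ_arrow]
  simp only [sum_fin_two_arrow]

theorem sum_fin_four_arrow {α M : Type*} [Fintype α] [AddCommMonoid M]
    (f : (Fin 4 → α) → M) : ∑ x, f x = ∑ a, ∑ b, ∑ c, ∑ d, f ![a, b, c, d] := by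
  rw [sum_fin_succ_arrow]
  simp only [sum_fin_three_arrow]

theorem vec_two_eta {α : Type*} (u : Fin 2 → α) : ![u 0, u 1] = u := by
  ext i; fin_cases i <;> rfl

theorem vec_three_eta {α : Type*} (u : Fin 3 → α) : ![u 0, u 1, u 2] = u := by
  ext i; fin_cases i <;> rfl

/-! ### The valence bond state and its noisy versions -/

theorem midOp_mulVec_apply (P : Projector) (v : Ket (Fin 4)) (x : Fin 3 → Fin 2) :
    (midOp P *ᵥ v) x = ∑ i, ∑ k, P (x 1) (i, k) * v ![x 0, i, k, x 2] := by
  simp only [Matrix.mulVec, dotProduct, midOp, Matrix.of_apply]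
  rw [sum_fin_four_arrow, Finset.sum_eq_single (x 0)]
  · refine Finset.sum_congr rfl fun i _ => Finset.sum_congr rfl fun k _ => ?_
    rw [Finset.sum_eq_single (x 2)]
    · rw [if_pos ⟨rfl, rfl⟩]; rfl
    · intro d _ hd
      rw [if_neg fun h => hd h.2, zero_mul]
    · simp
  · intro a _ ha
    refine Finset.sum_eq_zero fun i _ => Finset.sum_eq_zero fun k _ =>
      Finset.sum_eq_zero fun d _ => ?_
    rw [if_neg fun h => ha h.1, zero_mul]
  · simp

theorem vbs_apply (P : Projector) (x : Fin 3 → Fin 2) : vbs P x = P (x 1) (x 0, x 2) := by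
  rw [vbs, midOp_mulVec_apply, Finset.sum_eq_single (x 0), Finset.sum_eq_single (x 2)]
  · simp [tensor, bell]
  · intro k _ hk
    simp [tensor, bell, hk]
  · simp
  · intro i _ hi
    simp [tensor, bell, hi.symm]
  · simp

/-- The factor by which `Z`-noise on a qubit multiplies a matrix element. -/
def dephasing (p : ℝ) (a b : Fin 2) : ℂ := if a = b then 1 else 1 - 2 * p

/-- Each error only contributes signs to an entry, so the sum over error sets is the expansion of a
product over qubits. -/
theorem zNoise_apply {ι : Type} [Fintype ι] [DecidableEq ι] (p : ℝ) (ρ : Op ι)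
    (x y : ι → Fin 2) : zNoise p ρ x y = ρ x y * ∏ q, dephasing p (x q) (y q) := by
  have h : ∀ a b : Fin 2, dephasing p a b = p * ((-1) ^ (a : ℕ) * (-1) ^ (b : ℕ)) + (1 - p) := by
    intro a b
    fin_cases a <;> fin_cases b <;> simp [dephasing] <;> ring
  simp only [h]
  rw [Finset.prod_add, Finset.powerset_univ, zNoise, Matrix.sum_apply, Finset.mul_sum]
  refine Finset.sum_congr rfl fun s _ => ?_
  rw [zOn, Matrix.smul_apply, Matrix.mul_diagonal, Matrix.diagonal_mul, smul_eq_mul,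
    Finset.prod_mul_distrib, Finset.prod_mul_distrib, Finset.prod_const, Finset.prod_const,
    ← Finset.compl_eq_univ_sdiff]
  push_cast
  ring

theorem zNoise_posSemidef {ι : Type} [Fintype ι] [DecidableEq ι] {p : ℝ} (h0 : 0 ≤ p)
    (h1 : p ≤ 1) {ρ : Op ι} (hρ : ρ.PosSemidef) : (zNoise p ρ).PosSemidef := by
  refine Matrix.posSemidef_sum _ fun s _ => Matrix.PosSemidef.smul ?_ ?_
  · have : (zOn s)ᴴ = zOn s := by
      rw [zOn, Matrix.diagonal_conjTranspose]
      congr 1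
      ext x
      simp
    have h2 := hρ.mul_mul_conjTranspose_same (zOn s)
    rwa [this] at h2
  · have : 0 ≤ 1 - p := by linarith
    exact_mod_cast (by positivity : 0 ≤ p ^ s.card * (1 - p) ^ sᶜ.card)

theorem noisy_apply (P : Projector) (p : ℝ) (x y : Fin 3 → Fin 2) :
    noisy P p x y = P (x 1) (x 0, x 2) * star (P (y 1) (y 0, y 2)) *
      (dephasing p (x 0) (y 0) * dephasing p (x 1) (y 1) * dephasing p (x 2) (y 2)) := by
  rw [noisy, zNoise_apply, proj, Matrix.vecMulVec_apply, Pi.star_apply, vbs_apply, vbs_apply,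
    Fin.prod_univ_three]

theorem noisy12_apply (P : Projector) (p : ℝ) (x y : Fin 2 → Fin 2) :
    noisy12 P p x y = P (x 1) (x 0, 0) * star (P (y 1) (y 0, 0)) *
      (dephasing p (x 0) (y 0) * dephasing p (x 1) (y 1)) := by
  have h : dephasing p 0 0 = 1 := if_pos rfl
  rw [noisy12, Matrix.of_apply, noisy_apply]
  simp only [Matrix.cons_val, h, mul_one]

theorem noisy_posSemidef (P : Projector) {p : ℝ} (h0 : 0 ≤ p) (h1 : p ≤ 1) :
    (noisy P p).PosSemidef :=
  zNoise_posSemidef h0 h1 (Matrix.posSemidef_vecMulVec_self_star _)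

theorem noisy12_posSemidef (P : Projector) {p : ℝ} (h0 : 0 ≤ p) (h1 : p ≤ 1) :
    (noisy12 P p).PosSemidef := by
  have h : noisy12 P p = (noisy P p).submatrix (fun x => ![x 0, x 1, 0])
    fun x => ![x 0, x 1, 0] := by ext; rfl
  exact h ▸ (noisy_posSemidef P h0 h1).submatrix _

theorem noisy23_posSemidef (P : Projector) {p : ℝ} (h0 : 0 ≤ p) (h1 : p ≤ 1) :
    (noisy23 P p).PosSemidef := by
  have h : noisy23 P p = (noisy P p).submatrix (fun x => ![0, x 0, x 1])
    fun x => ![0, x 0, x 1] := by ext; rfl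
  exact h ▸ (noisy_posSemidef P h0 h1).submatrix _

theorem bell_ne_zero : bell ≠ 0 := fun h => by
  simpa [bell] using congrFun h ![0, 0]

theorem vbs_ne_zero {P : Projector} (h : IsUnit (slice P 0)) : vbs P ≠ 0 := by
  intro h0
  have : slice P 0 = 0 := by
    ext j i
    have := congrFun h0 ![i, j, 0]
    rw [vbs_apply] at this
    simpa [slice] using this
  rw [this] at h
  exact not_isUnit_zero h

/-! ### One edge bounds all purification protocols -/

section Edge

variable {P : Projector} {b : Fin 2 → Fin 2 → ℂ} {p : ℝ} {γ : Type} [Fintype γ] [DecidableEq γ]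

/-- The square roots of the probabilities of no error and of a `Z`-error, with the sign caused by
the error on the third qubit and the coefficient of the reconstruction. -/
noncomputable def rebuildCoeff (b : Fin 2 → Fin 2 → ℂ) (p : ℝ) (t j k : Fin 2) : ℂ :=
  ((√(if t = 0 then 1 - p else p) : ℝ) : ℂ) * (-1) ^ (t * k : ℕ) * b j k

/-- The factor `b j k` involves only the second and third qubits and is unaffected by dephasing.
Dephasing of the third qubit splits into an error-free and a `Z`-error term, labelled by `t`. -/
theorem noisy_eq_sum (hb : ∀ i j k, P j (i, k) = b j k * P j (i, 0)) (h0 : 0 ≤ p) (h1 : p ≤ 1)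
    (x y : Fin 3 → Fin 2) :
    noisy P p x y = ∑ t, rebuildCoeff b p t (x 1) (x 2) * star (rebuildCoeff b p t (y 1) (y 2)) *
      noisy12 P p ![x 0, x 1] ![y 0, y 1] := by
  have hs0 : ((√(1 - p) : ℝ) : ℂ) ^ 2 = 1 - p := by
    rw [← Complex.ofReal_pow, Real.sq_sqrt (by linarith)]; push_cast; ring
  have hs1 : ((√p : ℝ) : ℂ) ^ 2 = p := by
    rw [← Complex.ofReal_pow, Real.sq_sqrt h0]
  have hsum : ∀ k l : Fin 2, dephasing p k l =
      ((√(1 - p) : ℝ) : ℂ) ^ 2 + ((√p : ℝ) : ℂ) ^ 2 * ((-1) ^ (k : ℕ) * (-1) ^ (l : ℕ)) := by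
    intro k l
    rw [hs0, hs1]
    fin_cases k <;> fin_cases l <;> simp [dephasing] <;> ring
  rw [noisy_apply, noisy12_apply, hb (x 0), hb (y 0), hsum (x 2) (y 2)]
  simp only [rebuildCoeff, Fin.sum_univ_two, star_mul', star_pow, star_neg, star_one,
    Complex.star_def, Complex.conj_ofReal]
  simp
  ring

/-- The isometry-like map by which the second party rebuilds its two qubits in each copy, `t`
recording the copies in which it inflicts an error on the third qubit. -/
noncomputable def rebuild (b : Fin 2 → Fin 2 → ℂ) (p : ℝ) (t : γ → Fin 2) :
    Matrix (Fin 3 → γ → Fin 2) (Fin 2 → γ → Fin 2) ℂ :=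
  Matrix.of fun x y =>
    if ![x 0, x 1] = y then ∏ c, rebuildCoeff b p (t c) (x 1 c) (x 2 c) else 0

theorem tensorPower_noisy_eq_sum (hb : ∀ i j k, P j (i, k) = b j k * P j (i, 0))
    (h0 : 0 ≤ p) (h1 : p ≤ 1) : tensorPower γ (noisy P p) =
      ∑ t : γ → Fin 2, rebuild b p t * tensorPower γ (noisy12 P p) * (rebuild b p t)ᴴ := by
  ext x y
  simp only [tensorPower, Matrix.of_apply, noisy_eq_sum hb h0 h1]
  rw [Finset.prod_univ_sum, Fintype.piFinset_univ, Matrix.sum_apply]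
  refine Finset.sum_congr rfl fun t _ => ?_
  simp only [Matrix.mul_apply, rebuild, Matrix.of_apply, Matrix.conjTranspose_apply, ite_mul,
    zero_mul, Finset.sum_ite_eq, Finset.mem_univ, if_true, apply_ite star, star_zero, mul_ite,
    mul_zero, star_prod, Finset.prod_mul_distrib]
  rw [mul_right_comm]
  have h : ∀ (u : Fin 3 → γ → Fin 2) (c : γ),
      (fun q => (![u 0, u 1] : Fin 2 → γ → Fin 2) q c) = ![u 0 c, u 1 c] := by
    intro u c
    ext q
    fin_cases q <;> rfl
  simp only [h]

/-- Projection of the third qubit on `0`, followed by `G` on the second one. -/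
def closeEdge (G : Matrix (Fin 2) (Fin 2) ℂ) : Matrix (Fin 2 → Fin 2) (Fin 3 → Fin 2) ℂ :=
  Matrix.of fun z x => if x 0 = z 0 ∧ x 2 = 0 then G (z 1) (x 1) else 0

theorem sum_closeEdge_mul (G : Matrix (Fin 2) (Fin 2) ℂ) (z : Fin 2 → Fin 2)
    (f : (Fin 3 → Fin 2) → ℂ) :
    ∑ x, closeEdge G z x * f x = ∑ j, G (z 1) j * f ![z 0, j, 0] := by
  simp only [closeEdge, Matrix.of_apply]
  rw [sum_fin_three_arrow, Finset.sum_eq_single (z 0)]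
  · refine Finset.sum_congr rfl fun j _ => ?_
    rw [Finset.sum_eq_single 0]
    · rw [if_pos ⟨rfl, rfl⟩]; rfl
    · intro d _ hd
      rw [if_neg fun h => hd h.2, zero_mul]
    · simp
  · intro a _ ha
    refine Finset.sum_eq_zero fun j _ => Finset.sum_eq_zero fun d _ => ?_
    rw [if_neg fun h => ha h.1, zero_mul]
  · simp

/-- Outcome `0` on the third qubit leaves the amplitude matrix `slice P 0`, which `G` on the second
qubit inverts. -/
theorem closeEdge_mulVec_vbs {G : Matrix (Fin 2) (Fin 2) ℂ} (hG : G * slice P 0 = 1) :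
    closeEdge G *ᵥ vbs P = bell := by
  ext z
  have h : (G * slice P 0) (z 1) (z 0) = bell z := by
    rw [hG, Matrix.one_apply, bell]; simp only [eq_comm]
  rw [← h]
  simp only [Matrix.mulVec, dotProduct, Matrix.mul_apply, sum_closeEdge_mul, vbs_apply]
  rfl

/-- Sites 2 and 3 belong to one party here, so the composite is local for two parties. Only row `0`
of `A 2` survives the projection of the third output. -/
theorem closeEdge_mul_localQubitOp_mul_rebuild (G : Matrix (Fin 2) (Fin 2) ℂ)
    (A : Fin 3 → Matrix (Fin 2) (γ → Fin 2) ℂ) (t : γ → Fin 2) :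
    closeEdge G * localQubitOp A * rebuild b p t =
      localQubitOp ![A 0, Matrix.of fun j u => (G * A 1) j u *
        ∑ v, (∏ c, rebuildCoeff b p (t c) (u c) (v c)) * A 2 0 v] := by
  have h1 : ∀ z x, (closeEdge G * localQubitOp A) z x
      = A 0 (z 0) (x 0) * (G * A 1) (z 1) (x 1) * A 2 0 (x 2) := by
    intro z x
    simp only [Matrix.mul_apply, sum_closeEdge_mul, localQubitOp, Matrix.of_apply,
      Fin.prod_univ_three, Matrix.cons_val, Finset.mul_sum, Finset.sum_mul]
    exact Finset.sum_congr rfl fun _ _ => by ring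
  ext z y
  rw [Matrix.mul_apply, sum_fin_three_arrow]
  simp only [h1]
  simp only [rebuild, localQubitOp, Matrix.of_apply, Fin.prod_univ_two, Matrix.cons_val]
  rw [Finset.sum_eq_single (y 0), Finset.sum_eq_single (y 1)]
  · simp only [vec_two_eta, if_true, Finset.mul_sum]
    exact Finset.sum_congr rfl fun _ _ => by ring
  · intro u _ hu
    refine Finset.sum_eq_zero fun v _ => ?_
    have h : ¬ ![y 0, u] = y := fun h => hu (congrFun h 1)
    exact mul_eq_zero_of_right _ (if_neg h)
  · simp
  · intro u _ hu
    refine Finset.sum_eq_zero fun v _ => Finset.sum_eq_zero fun w _ => ?_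
    have h : ¬ ![u, v] = y := fun h => hu (congrFun h 0)
    exact mul_eq_zero_of_right _ (if_neg h)
  · simp

theorem purifiable_noisy12 (hb : ∀ i j k, P j (i, k) = b j k * P j (i, 0))
    (hP : IsUnit (slice P 0)) (h0 : 0 ≤ p) (h1 : p ≤ 1) (h : Purifiable (noisy P p) (vbs P)) :
    Purifiable (noisy12 P p) bell := by
  refine purifiable_of_distill fun ε hε => ?_
  obtain ⟨G, hG⟩ := hP.exists_left_inv
  obtain ⟨δ, hδ, H⟩ := exists_isClose_conj (closeEdge G) (ψ := vbs P)
    (by rw [closeEdge_mulVec_vbs hG]; exact bell_ne_zero) hε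
  obtain ⟨n, S, hS⟩ := h δ hδ
  obtain ⟨A, hA⟩ := exists_isClose_distill S (vbs_ne_zero hP) (noisy_posSemidef P h0 h1) hS
  have h2 := H _ (distill_posSemidef A (noisy_posSemidef P h0 h1)) hA
  rw [closeEdge_mulVec_vbs hG, distill, tensorPower_noisy_eq_sum hb h0 h1] at h2
  simp only [Matrix.mul_sum, Matrix.sum_mul] at h2
  have h3 : ∀ t : Fin n → Fin 2, closeEdge G * (localQubitOp A *
        (rebuild b p t * tensorPower (Fin n) (noisy12 P p) * (rebuild b p t)ᴴ) *
        (localQubitOp A)ᴴ) * (closeEdge G)ᴴ =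
      distill ![A 0, Matrix.of fun j u => (G * A 1) j u *
        ∑ v, (∏ c, rebuildCoeff b p (t c) (u c) (v c)) * A 2 0 v] (noisy12 P p) := by
    intro t
    rw [distill, ← closeEdge_mul_localQubitOp_mul_rebuild (b := b) (p := p) G A t,
      Matrix.conjTranspose_mul, Matrix.conjTranspose_mul]
    simp only [Matrix.mul_assoc]
  simp only [h3] at h2
  -- The simulated protocol is a mixture over error patterns on the created qubits; the best pattern
  -- gives fixed local operators.
  obtain ⟨t, ht⟩ := exists_isClose_of_sum bell_ne_zero
    (fun t => distill_posSemidef _ (noisy12_posSemidef P h0 h1)) h2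
  exact ⟨Fin n, inferInstance, inferInstance, _, ht⟩

end Edge

/-! ### The reconstruction conditions -/

theorem zOn_singleton_mulVec {ι : Type} [Fintype ι] [DecidableEq ι] (q : ι) (ψ : Ket ι)
    (x : ι → Fin 2) : (zOn {q} *ᵥ ψ) x = (-1) ^ (x q : ℕ) * ψ x := by
  rw [zOn, Matrix.mulVec_diagonal, Finset.prod_singleton]

theorem pauliZ_eq_diagonal : pauliZ = Matrix.diagonal fun j : Fin 2 => (-1 : ℂ) ^ (j : ℕ) := by
  ext i j
  fin_cases i <;> fin_cases j <;> simp [pauliZ]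

/-- The right-hand form is what carrying a `Z`-error through the reconstruction says entrywise. -/
theorem mul_eq_and_commutator_iff {A B C : Matrix (Fin 2) (Fin 2) ℂ} :
    (B * A = C ∧ (B * pauliZ - pauliZ * B) * A = 0) ↔
      (B * A = C ∧ B * (pauliZ * A) = pauliZ * C) := by
  refine and_congr_right fun h => ?_
  rw [Matrix.sub_mul, sub_eq_zero, Matrix.mul_assoc, Matrix.mul_assoc, h]

theorem reconstructs12_iff (P₀ P₁ : Projector) : Reconstructs12 P₀ P₁ ↔
    (∀ i, slice P₁ i * slice P₀ 0 = slice P₀ i) ∧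
    (∀ i, (slice P₁ i * pauliZ - pauliZ * slice P₁ i) * slice P₀ 0 = 0) := by
  rw [← forall_and]
  simp only [mul_eq_and_commutator_iff]
  rw [forall_and, Reconstructs12]
  refine and_congr ?_ ?_
  · have h : ∀ x : Fin 3 → Fin 2, (midOp P₁ *ᵥ tensor (pair12 P₀) bell) x
        = (slice P₁ (x 2) * slice P₀ 0) (x 1) (x 0) := by
      intro x
      rw [midOp_mulVec_apply, Matrix.mul_apply]
      refine Finset.sum_congr rfl fun i _ => ?_
      rw [Finset.sum_eq_single (x 2)]
      · simp [tensor, bell, pair12, vbs_apply, slice]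
      · intro k _ hk
        simp [tensor, bell, hk]
      · simp
    refine ⟨fun H k => ?_, fun H => ?_⟩
    · ext j i
      have := congrFun H ![i, j, k]
      rw [h, vbs_apply] at this
      exact this
    · ext x
      rw [h, H, vbs_apply]
      rfl
  · have h : ∀ x : Fin 3 → Fin 2, (midOp P₁ *ᵥ (zOn {1} *ᵥ tensor (pair12 P₀) bell)) x
        = (slice P₁ (x 2) * (pauliZ * slice P₀ 0)) (x 1) (x 0) := by
      intro x
      rw [midOp_mulVec_apply, Matrix.mul_apply]
      refine Finset.sum_congr rfl fun i _ => ?_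
      rw [pauliZ_eq_diagonal, Matrix.diagonal_mul, Finset.sum_eq_single (x 2)]
      · simp [zOn_singleton_mulVec, tensor, bell, pair12, vbs_apply, slice]
      · intro k _ hk
        simp [zOn_singleton_mulVec, tensor, bell, hk]
      · simp
    have h' : ∀ x : Fin 3 → Fin 2, (zOn {1} *ᵥ vbs P₀) x
        = (pauliZ * slice P₀ (x 2)) (x 1) (x 0) := by
      intro x
      rw [pauliZ_eq_diagonal, Matrix.diagonal_mul, zOn_singleton_mulVec, vbs_apply]
      rfl
    refine ⟨fun H k => ?_, fun H => ?_⟩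
    · ext j i
      have := congrFun H ![i, j, k]
      rw [h, h'] at this
      exact this
    · ext x
      rw [h, h', H]

/-- The mirror image of a projector. -/
def mirror (P : Projector) : Projector := P.submatrix id Prod.swap

theorem slice_mirror (P : Projector) (i : Fin 2) : slice (mirror P) i = coslice P i := rfl

theorem mirror_mirror (P : Projector) : mirror (mirror P) = P := rfl

theorem vbs_mirror (P : Projector) : vbs (mirror P) = vbs P ∘ relabel Fin.revPerm _ := by
  ext x
  rw [Function.comp, vbs_apply, vbs_apply]
  rfl

theorem noisy_mirror (P : Projector) (p : ℝ) : noisy (mirror P) p =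
    (noisy P p).submatrix (relabel Fin.revPerm _) (relabel Fin.revPerm _) := by
  ext x y
  rw [Matrix.submatrix_apply, noisy_apply, noisy_apply]
  simp only [relabel, mirror, Equiv.arrowCongr_apply, Equiv.coe_refl, Function.comp,
    Equiv.symm_symm, Fin.revPerm_apply, Matrix.submatrix_apply, id, Prod.swap_prod_mk]
  rw [show (2 : Fin 3).rev = 0 from rfl, show (1 : Fin 3).rev = 1 from rfl,
    show (0 : Fin 3).rev = 2 from rfl]
  ring

theorem noisy23_eq_mirror (P : Projector) (p : ℝ) : noisy23 P p =
    (noisy12 (mirror P) p).submatrix (relabel Fin.revPerm _) (relabel Fin.revPerm _) := by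
  ext x y
  rw [Matrix.submatrix_apply, noisy12, noisy23, Matrix.of_apply, Matrix.of_apply, noisy_mirror,
    Matrix.submatrix_apply]
  congr 1 <;> (ext i; fin_cases i <;> rfl)

theorem bell_comp_rev : bell ∘ relabel Fin.revPerm _ = bell := by
  ext x
  simp only [Function.comp, bell, relabel]
  exact if_congr eq_comm rfl rfl

theorem reconstructs23_iff_mirror (P₀ P₁ : Projector) :
    Reconstructs23 P₀ P₁ ↔ Reconstructs12 (mirror P₀) (mirror P₁) := by
  have hpair : ∀ a b, pair12 (mirror P₀) ![a, b] = pair23 P₀ ![b, a] := by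
    intro a b
    simp [pair12, pair23, vbs_apply, mirror]
  have hvbs : ∀ a b c, vbs (mirror P₀) ![a, b, c] = vbs P₀ ![c, b, a] := by
    intro a b c
    simp [vbs_apply, mirror]
  have hb : ∀ a b, bell ![a, b] = bell ![b, a] := by
    intro a b
    simp only [bell, Matrix.cons_val]
    exact if_congr eq_comm rfl rfl
  -- Reversing the order of the qubits intertwines `midOp P₁` with `midOp (mirror P₁)`; both
  -- reconstruction equations are instances.
  have key : ∀ {v w : Ket (Fin 4)} {s t : Ket (Fin 3)},
      (∀ a b c d, v ![a, b, c, d] = w ![d, c, b, a]) → (∀ a b c, s ![a, b, c] = t ![c, b, a]) →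
      (midOp P₁ *ᵥ v = s ↔ midOp (mirror P₁) *ᵥ w = t) := by
    intro v w s t hvw hst
    have h : ∀ a b c, (midOp P₁ *ᵥ v) ![a, b, c] = (midOp (mirror P₁) *ᵥ w) ![c, b, a] := by
      intro a b c
      rw [midOp_mulVec_apply, midOp_mulVec_apply, Finset.sum_comm]
      simp [hvw, mirror]
    refine ⟨fun H => ?_, fun H => ?_⟩
    · ext x
      rw [← vec_three_eta x, ← h, H, hst]
    · ext x
      rw [← vec_three_eta x, h, H, hst]
  refine and_congr (key ?_ ?_) (key ?_ ?_)
  · intro a b c d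
    simp [tensor, hpair, hb a b, mul_comm]
  · intro a b c
    rw [hvbs]
  · intro a b c d
    simp [zOn_singleton_mulVec, tensor, hpair, hb a b, mul_comm]
  · intro a b c
    simp [zOn_singleton_mulVec, hvbs]

theorem reconstructs23_iff (P₀ P₁ : Projector) : Reconstructs23 P₀ P₁ ↔
    (∀ i, coslice P₁ i * coslice P₀ 0 = coslice P₀ i) ∧
    (∀ i, (coslice P₁ i * pauliZ - pauliZ * coslice P₁ i) * coslice P₀ 0 = 0) := by
  rw [reconstructs23_iff_mirror, reconstructs12_iff]
  rfl

theorem exists_reconstructs23_iff (P : Projector) :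
    (∃ P₁, Reconstructs23 P P₁) ↔ ∃ P₁, Reconstructs12 (mirror P) P₁ :=
  ⟨fun ⟨P₁, h⟩ => ⟨mirror P₁, (reconstructs23_iff_mirror _ _).mp h⟩,
    fun ⟨P₁, h⟩ => ⟨mirror P₁, (reconstructs23_iff_mirror _ _).mpr h⟩⟩

theorem apply_eq_zero_of_commute_pauliZ {B : Matrix (Fin 2) (Fin 2) ℂ}
    (h : B * pauliZ - pauliZ * B = 0) {i j : Fin 2} (hij : i ≠ j) : B i j = 0 := by
  have := congrFun (congrFun h i) j
  rw [pauliZ_eq_diagonal, Matrix.sub_apply, Matrix.mul_diagonal, Matrix.diagonal_mul] at this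
  fin_cases i <;> fin_cases j <;> simp at hij this ⊢
  · linear_combination (-1 / 2) * this
  · exact this

theorem commute_pauliZ_diagonal (b : Fin 2 → ℂ) :
    Matrix.diagonal b * pauliZ - pauliZ * Matrix.diagonal b = 0 := by
  rw [pauliZ_eq_diagonal, Matrix.diagonal_mul_diagonal, Matrix.diagonal_mul_diagonal, sub_eq_zero]
  simp only [mul_comm]

/-- Reconstructibility means that every matrix `α^k` arises from `α^0` by rescaling its rows. -/
theorem exists_reconstructs12_of_rescaling {P : Projector} {b : Fin 2 → Fin 2 → ℂ}
    (hb : ∀ i j k, P j (i, k) = b j k * P j (i, 0)) : ∃ P₁, Reconstructs12 P P₁ := by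
  let P₁ : Projector := Matrix.of fun j ik => if j = ik.1 then b j ik.2 else 0
  have h : ∀ k, slice P₁ k = Matrix.diagonal fun j => b j k := by
    intro k
    ext j i
    simp [P₁, slice, Matrix.diagonal_apply]
  refine ⟨P₁, (reconstructs12_iff _ _).mpr ⟨fun k => ?_, fun k => ?_⟩⟩
  · ext j i
    rw [h, Matrix.diagonal_mul]
    exact (hb i j k).symm
  · rw [h, commute_pauliZ_diagonal, Matrix.zero_mul]

/-- Cancelling the invertible `slice P 0` makes the commutator itself vanish, so `slice P₁ k` is
diagonal and its diagonal supplies the factors. -/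
theorem exists_rescaling {P : Projector} (hP : IsUnit (slice P 0))
    (h : ∃ P₁, Reconstructs12 P P₁) :
    ∃ b : Fin 2 → Fin 2 → ℂ, ∀ i j k, P j (i, k) = b j k * P j (i, 0) := by
  obtain ⟨P₁, h⟩ := h
  rw [reconstructs12_iff] at h
  refine ⟨fun j k => slice P₁ k j j, fun i j k => ?_⟩
  have h2 : slice P₁ k * pauliZ - pauliZ * slice P₁ k = 0 := by
    rw [← hP.mul_left_inj, h.2 k, zero_mul]
  have h1 := congrFun (congrFun (h.1 k) j) i
  rw [Matrix.mul_apply, Finset.sum_eq_single j] at h1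
  · exact h1.symm
  · intro l _ hl
    rw [apply_eq_zero_of_commute_pauliZ h2 hl.symm, zero_mul]
  · simp

theorem exists_reconstructs12_iff_isDiag {P : Projector} (h0 : IsUnit (slice P 0))
    (h1 : IsUnit (slice P 1)) :
    (∃ P₁, Reconstructs12 P P₁) ↔ (slice P 0 * (slice P 1)⁻¹).IsDiag := by
  have hd1 := (Matrix.isUnit_iff_isUnit_det _).mp h1
  constructor
  · intro h
    obtain ⟨b, hb⟩ := exists_rescaling h0 h
    have hs : slice P 1 = Matrix.diagonal (fun j => b j 1) * slice P 0 := by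
      ext j i
      rw [Matrix.diagonal_mul]
      exact hb i j 1
    have hu : IsUnit (Matrix.diagonal fun j => b j 1) := by
      rw [Matrix.isUnit_iff_isUnit_det]
      rw [hs, Matrix.det_mul] at hd1
      exact isUnit_of_mul_isUnit_left hd1
    have hb0 : ∀ j, b j 1 ≠ 0 := by
      rw [Matrix.isUnit_diagonal, Pi.isUnit_iff] at hu
      exact fun j => (hu j).ne_zero
    have hs' : slice P 0 = Matrix.diagonal (fun j => (b j 1)⁻¹) * slice P 1 := by
      rw [hs, ← Matrix.mul_assoc, Matrix.diagonal_mul_diagonal]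
      simp [hb0]
    rw [hs', Matrix.mul_nonsing_inv_cancel_right _ _ hd1]
    exact Matrix.isDiag_diagonal _
  · intro h
    obtain ⟨d, hd⟩ := (Matrix.isDiag_iff_diagonal_diag _).mp h ▸
      (⟨(slice P 0 * (slice P 1)⁻¹).diag, rfl⟩ :
        ∃ d, Matrix.diagonal (slice P 0 * (slice P 1)⁻¹).diag = Matrix.diagonal d)
    have hs : slice P 0 = Matrix.diagonal d * slice P 1 := by
      rw [← hd, Matrix.mul_assoc, Matrix.nonsing_inv_mul _ hd1, Matrix.mul_one]
    have hu : IsUnit (Matrix.diagonal d) := by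
      rw [Matrix.isUnit_iff_isUnit_det]
      have hd0 := (Matrix.isUnit_iff_isUnit_det _).mp h0
      rw [hs, Matrix.det_mul] at hd0
      exact isUnit_of_mul_isUnit_left hd0
    have hd0 : ∀ j, d j ≠ 0 := by
      rw [Matrix.isUnit_diagonal, Pi.isUnit_iff] at hu
      exact fun j => (hu j).ne_zero
    -- The slice `0` is rescaled by `1`; the slice `1` is recovered by inverting `d`, whose entries
    -- are non-zero because `slice P 0` is invertible.
    refine exists_reconstructs12_of_rescaling (b := fun j k => if k = 0 then 1 else (d j)⁻¹)
      fun i j k => ?_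
    have := congrFun (congrFun hs j) i
    rw [Matrix.diagonal_mul] at this
    simp only [slice, Matrix.of_apply] at this
    fin_cases k
    · simp
    · simp [this, hd0 j]

/-! ### The explicit family -/

theorem exists_rescaling_family {a b c : Fin 2 → ℂ} (h : ∀ j, b j ≠ 0 ∧ c j ≠ 0) :
    ∀ i j k, family a b c j (i, k) =
      (fun j k : Fin 2 => if k = 0 then 1 else c j / b j) j k * family a b c j (i, 0) := by
  intro i j k
  have := h j
  fin_cases i <;> fin_cases k <;> simp [family] <;> field_simp [this.1, this.2]

theorem mirror_family (a b c : Fin 2 → ℂ) : mirror (family a b c) = family b a c := by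
  ext j ⟨i, k⟩
  fin_cases i <;> fin_cases k <;> simp [mirror, family, mul_comm]

theorem isUnit_slice_family {a b c : Fin 2 → ℂ} (h : ∀ j, b j ≠ 0 ∧ c j ≠ 0)
    (hac : a 0 * c 1 ≠ a 1 * c 0) : IsUnit (slice (family a b c) 0) := by
  rw [Matrix.isUnit_iff_isUnit_det, isUnit_iff_ne_zero, Matrix.det_fin_two]
  simp only [slice, family, Matrix.of_apply, Matrix.cons_val]
  have h0 := h 0
  have h1 := h 1
  have : a 0 * b 0 / c 0 * b 1 - b 0 * (a 1 * b 1 / c 1)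
      = b 0 * b 1 / (c 0 * c 1) * (a 0 * c 1 - a 1 * c 0) := by
    have := h0.2
    have := h1.2
    field_simp
  rw [this]
  exact mul_ne_zero (div_ne_zero (mul_ne_zero h0.1 h1.1) (mul_ne_zero h0.2 h1.2))
    (sub_ne_zero.mpr hac)

theorem exists_reconstructs12_iff_family {P : Projector} (hs : ∀ k, IsUnit (slice P k))
    (hc : ∀ i, IsUnit (coslice P i)) : (∃ P₁, Reconstructs12 P P₁) ↔
      ∃ a b c, (∀ j, c j ≠ 0) ∧ P = family a b c := by
  rw [exists_reconstructs12_iff_isDiag (hs 0) (hs 1)]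
  have hd1 := (Matrix.isUnit_iff_isUnit_det _).mp (hs 1)
  constructor
  · intro h
    set d := (slice P 0 * (slice P 1)⁻¹).diag
    have hP : slice P 0 = Matrix.diagonal d * slice P 1 := by
      rw [(Matrix.isDiag_iff_diagonal_diag _).mp h, Matrix.mul_assoc,
        Matrix.nonsing_inv_mul _ hd1, Matrix.mul_one]
    have hP' : ∀ i j, P j (i, 0) = d j * P j (i, 1) := by
      intro i j
      have := congrFun (congrFun hP j) i
      rwa [Matrix.diagonal_mul] at this
    have hc1 : ∀ j, P j (1, 1) ≠ 0 := by
      intro j hj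
      -- A zero at `(1, 1)` would, by proportionality, annihilate a whole row of the invertible
      -- matrix `coslice P 1`.
      have hrow : ∀ k, coslice P 1 j k = 0 := by
        intro k
        fin_cases k
        · simp [coslice, hP', hj]
        · simpa [coslice] using hj
      have := (Matrix.isUnit_iff_isUnit_det _).mp (hc 1)
      rw [Matrix.det_eq_zero_of_row_eq_zero j hrow] at this
      exact not_isUnit_zero this
    refine ⟨fun j => P j (0, 1), fun j => P j (1, 0), fun j => P j (1, 1), hc1, ?_⟩
    ext j ⟨i, k⟩
    have := hc1 j
    fin_cases i <;> fin_cases k <;> simp [family]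
    rw [hP' 1 j, hP' 0 j]
    field_simp
  · rintro ⟨a, b, c, hc0, rfl⟩
    have : slice (family a b c) 0 = Matrix.diagonal (fun j => b j / c j) *
        slice (family a b c) 1 := by
      ext j i
      have := hc0 j
      rw [Matrix.diagonal_mul]
      fin_cases i <;> simp [slice, family] <;> field_simp
    rw [this, Matrix.mul_nonsing_inv_cancel_right _ _ hd1]
    exact Matrix.isDiag_diagonal _

theorem exists_reconstructs23_iff_family {P : Projector} (hs : ∀ k, IsUnit (slice P k))
    (hc : ∀ i, IsUnit (coslice P i)) : (∃ P₁, Reconstructs23 P P₁) ↔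
      ∃ a b c, (∀ j, c j ≠ 0) ∧ P = family a b c := by
  rw [exists_reconstructs23_iff, exists_reconstructs12_iff_family (P := mirror P) hc hs]
  constructor
  · rintro ⟨a, b, c, h, hP⟩
    exact ⟨b, a, c, h, by rw [← mirror_family, ← hP, mirror_mirror]⟩
  · rintro ⟨a, b, c, h, rfl⟩
    exact ⟨b, a, c, h, mirror_family a b c⟩

/-! ### The divide and rebuild protocol -/

theorem purifiable_noisy12_of_reconstructs {P : Projector} (hP : IsUnit (slice P 0))
    (hr : ∃ P₁, Reconstructs12 P P₁) {p : ℝ} (h0 : 0 ≤ p) (h1 : p ≤ 1)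
    (h : Purifiable (noisy P p) (vbs P)) : Purifiable (noisy12 P p) bell :=
  let ⟨_, hb⟩ := exists_rescaling hP hr
  purifiable_noisy12 hb hP h0 h1 h

theorem purifiable_noisy23_of_reconstructs {P : Projector} (hP : IsUnit (coslice P 0))
    (hr : ∃ P₁, Reconstructs23 P P₁) {p : ℝ} (h0 : 0 ≤ p) (h1 : p ≤ 1)
    (h : Purifiable (noisy P p) (vbs P)) : Purifiable (noisy23 P p) bell := by
  have hv : vbs P ≠ 0 := by
    intro h2
    refine vbs_ne_zero (P := mirror P) hP ?_
    rw [vbs_mirror, h2]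
    rfl
  have h2 := h.relabel Fin.revPerm hv (noisy_posSemidef P h0 h1)
  rw [← noisy_mirror, ← vbs_mirror] at h2
  have h3 := purifiable_noisy12_of_reconstructs (P := mirror P) hP
    ((exists_reconstructs23_iff P).mp hr) h0 h1 h2
  have h4 := h3.relabel Fin.revPerm bell_ne_zero (noisy12_posSemidef _ h0 h1)
  rwa [← noisy23_eq_mirror, bell_comp_rev] at h4

/-- Splitting of four qubits into two pairs. -/
def splitFour : (Fin 4 → Fin 2) ≃ (Fin 2 → Fin 2) × (Fin 2 → Fin 2) where
  toFun x := (![x 0, x 1], ![x 2, x 3])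
  invFun u := ![u.1 0, u.1 1, u.2 0, u.2 1]
  left_inv x := by ext i; fin_cases i <;> rfl
  right_inv u := by
    ext i <;> fin_cases i <;> rfl

theorem tensorOp_eq_submatrix (σ τ : Op (Fin 2)) :
    tensorOp σ τ = (Matrix.kronecker σ τ).submatrix splitFour splitFour := rfl

theorem tensorOp_posSemidef {σ τ : Op (Fin 2)} (hσ : σ.PosSemidef) (hτ : τ.PosSemidef) :
    (tensorOp σ τ).PosSemidef := by
  rw [tensorOp_eq_submatrix]
  exact (hσ.kronecker hτ).submatrix _

theorem trace_tensorOp (σ τ : Op (Fin 2)) : (tensorOp σ τ).trace = σ.trace * τ.trace := by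
  rw [← Matrix.trace_kronecker, tensorOp_eq_submatrix]
  exact splitFour.sum_comp fun u => Matrix.kronecker σ τ u u

theorem star_tensor_dotProduct (ξ η ξ' η' : Ket (Fin 2)) :
    star (tensor ξ η) ⬝ᵥ tensor ξ' η' = (star ξ ⬝ᵥ ξ') * (star η ⬝ᵥ η') := by
  simp only [dotProduct]
  rw [Finset.sum_mul_sum, ← Fintype.sum_prod_type', ← splitFour.sum_comp]
  refine Finset.sum_congr rfl fun x _ => ?_
  simp only [tensor, splitFour, Pi.star_apply, star_mul', Equiv.coe_fn_mk]
  ring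

theorem tensorOp_mulVec_tensor (σ τ : Op (Fin 2)) (ξ η : Ket (Fin 2)) :
    tensorOp σ τ *ᵥ tensor ξ η = tensor (σ *ᵥ ξ) (τ *ᵥ η) := by
  ext x
  simp only [tensor, Matrix.mulVec, dotProduct]
  rw [Finset.sum_mul_sum, ← Fintype.sum_prod_type', ← splitFour.sum_comp]
  refine Finset.sum_congr rfl fun x _ => ?_
  simp only [tensorOp, splitFour, Matrix.of_apply, Equiv.coe_fn_mk]
  ring

/-- Fidelity is multiplicative under tensor products, and `(1 - δ) ^ 2 ≥ 1 - 2 * δ`. -/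
theorem isClose_tensorOp {σ τ : Op (Fin 2)} (hσ : σ.PosSemidef) {δ : ℝ} (hδ : δ ≤ 1) (h1 : IsClose δ σ bell) (h2 : IsClose δ τ bell) :
    IsClose (2 * δ) (tensorOp σ τ) (tensor bell bell) := by
  have hre : ∀ {z w : ℂ}, 0 ≤ z → (z * w).re = z.re * w.re := by
    intro z w hz
    rw [Complex.mul_re, ← (Complex.nonneg_iff.mp hz).2, zero_mul, sub_zero]
  have hb : 0 ≤ star bell ⬝ᵥ bell := dotProduct_star_self_nonneg bell
  have htr : (tensorOp σ τ).trace.re = σ.trace.re * τ.trace.re := by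
    rw [trace_tensorOp, hre hσ.trace_nonneg]
  have hfid : fidelity (tensorOp σ τ) (tensor bell bell) = fidelity σ bell * fidelity τ bell := by
    rw [fidelity, fidelity, fidelity, tensorOp_mulVec_tensor, star_tensor_dotProduct,
      star_tensor_dotProduct, htr, hre hb, hre (hσ.dotProduct_mulVec_nonneg _), div_mul_div_comm]
    congr 1
    ring
  refine ⟨by rw [htr]; exact mul_pos h1.1 h2.1, ?_⟩
  rw [hfid]
  have := mul_le_mul h1.2 h2.2 (by linarith) (by linarith [h1.2])
  nlinarith [sq_nonneg δ]

/-- If both edges are purified well enough, the projector yields the valence bond state. -/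
theorem exists_isClose_midOp {P : Projector} (hP : vbs P ≠ 0) {ε : ℝ} (hε : 0 < ε) :
    ∃ δ : ℝ, 0 < δ ∧ δ ≤ ε ∧ ∀ σ τ : Op (Fin 2), σ.PosSemidef → τ.PosSemidef →
      IsClose δ σ bell → IsClose δ τ bell →
      IsClose ε (midOp P * tensorOp σ τ * (midOp P)ᴴ) (vbs P) := by
  obtain ⟨δ, hδ, H⟩ := exists_isClose_conj (midOp P) (ψ := tensor bell bell) hP hε
  -- Two imperfect pairs double the error, hence `δ / 2`; the bound `1` serves `isClose_tensorOp`,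
  -- and `ε` the closeness required of each pair.
  refine ⟨min (min (δ / 2) 1) ε, by positivity, min_le_right _ _, fun σ τ hσ hτ h1 h2 => ?_⟩
  have hle : min (min (δ / 2) 1) ε ≤ δ / 2 := (min_le_left _ _).trans (min_le_left _ _)
  have hle' : min (min (δ / 2) 1) ε ≤ 1 := (min_le_left _ _).trans (min_le_right _ _)
  exact H _ (tensorOp_posSemidef hσ hτ)
    ((isClose_tensorOp hσ hle' h1 h2).mono (by linarith))

section Combine

variable {γ δ : Type} [Fintype γ] [Fintype δ]

/-- Copies whose third qubit is projected on `0`, together with copies whose first qubit is. -/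
def combine (u : (Fin 2 → γ → Fin 2) × (Fin 2 → δ → Fin 2)) : Fin 3 → γ ⊕ δ → Fin 2 :=
  ![Sum.elim (u.1 0) 0, Sum.elim (u.1 1) (u.2 0), Sum.elim 0 (u.2 1)]

/-- Fixing a qubit to `0` on both sides is the postselected `Z`-measurement: on the third qubit for
copies in `γ`, on the first for those in `δ`. -/
theorem tensorPower_combine (P : Projector) (p : ℝ) :
    (tensorPower (γ ⊕ δ) (noisy P p)).submatrix combine combine =
      Matrix.kronecker (tensorPower γ (noisy12 P p)) (tensorPower δ (noisy23 P p)) := by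
  have h1 : ∀ (u : (Fin 2 → γ → Fin 2) × (Fin 2 → δ → Fin 2)) (c : γ),
      (fun q => combine u q (Sum.inl c)) = ![u.1 0 c, u.1 1 c, 0] := by
    intro u c; ext q; fin_cases q <;> rfl
  have h2 : ∀ (u : (Fin 2 → γ → Fin 2) × (Fin 2 → δ → Fin 2)) (c : δ),
      (fun q => combine u q (Sum.inr c)) = ![0, u.2 0 c, u.2 1 c] := by
    intro u c; ext q; fin_cases q <;> rfl
  ext u v
  simp only [Matrix.submatrix_apply, tensorPower, Matrix.of_apply, Fintype.prod_sum_type, h1, h2,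
    Matrix.kronecker, Matrix.kroneckerMap_apply]
  rfl

variable [DecidableEq γ] [DecidableEq δ]

/-- The local operators of the three parties in the divide and rebuild protocol. -/
def combinedOps (P : Projector) (A : Fin 2 → Matrix (Fin 2) (γ → Fin 2) ℂ)
    (B : Fin 2 → Matrix (Fin 2) (δ → Fin 2) ℂ) :
    Fin 3 → Matrix (Fin 2) (γ ⊕ δ → Fin 2) ℂ :=
  ![Matrix.of fun j u => if u ∘ Sum.inr = 0 then A 0 j (u ∘ Sum.inl) else 0,
    Matrix.of fun j u => ∑ i, ∑ k, P j (i, k) * (A 1 i (u ∘ Sum.inl) * B 0 k (u ∘ Sum.inr)),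
    Matrix.of fun j u => if u ∘ Sum.inl = 0 then B 1 j (u ∘ Sum.inr) else 0]

/-- The middle party holds an end of both purified pairs, so measuring, distilling and applying `P`
remain local. -/
theorem localQubitOp_combinedOps (P : Projector) (A : Fin 2 → Matrix (Fin 2) (γ → Fin 2) ℂ)
    (B : Fin 2 → Matrix (Fin 2) (δ → Fin 2) ℂ) :
    localQubitOp (combinedOps P A B) = midOp P *
      (Matrix.kronecker (localQubitOp A) (localQubitOp B)).submatrix splitFour id *
      (1 : Matrix (Fin 3 → γ ⊕ δ → Fin 2) (Fin 3 → γ ⊕ δ → Fin 2) ℂ).submatrix combine id := by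
  have h1 : ∀ z u, (midOp P *
      (Matrix.kronecker (localQubitOp A) (localQubitOp B)).submatrix splitFour id) z u =
      A 0 (z 0) (u.1 0) * (∑ i, ∑ k, P (z 1) (i, k) * (A 1 i (u.1 1) * B 0 k (u.2 0))) *
        B 1 (z 2) (u.2 1) := by
    intro z u
    have h := midOp_mulVec_apply P (fun y =>
      (Matrix.kronecker (localQubitOp A) (localQubitOp B)).submatrix splitFour id y u) z
    refine h.trans ?_
    simp only [Matrix.submatrix_apply, Matrix.kronecker, Matrix.kroneckerMap_apply, localQubitOp,
      Matrix.of_apply, Fin.prod_univ_two, Finset.mul_sum, Finset.sum_mul]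
    refine Finset.sum_congr rfl fun i _ => Finset.sum_congr rfl fun k _ => ?_
    simp [splitFour]
    ring
  ext z x
  rw [Matrix.mul_apply]
  simp only [h1, Matrix.submatrix_apply, id, Matrix.one_apply]
  simp only [localQubitOp, combinedOps, Matrix.of_apply, Fin.prod_univ_three, Matrix.cons_val]
  by_cases hx : x 0 ∘ Sum.inr = 0 ∧ x 2 ∘ Sum.inl = 0
  · rw [if_pos hx.1, if_pos hx.2, Finset.sum_eq_single
      (![x 0 ∘ Sum.inl, x 1 ∘ Sum.inl], ![x 1 ∘ Sum.inr, x 2 ∘ Sum.inr])]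
    · rw [if_pos]
      · simp
      · rw [← vec_three_eta x]
        simp [combine, ← hx.1, ← hx.2]
    · intro u _ hu
      refine mul_eq_zero_of_right _ (if_neg fun h => hu ?_)
      rw [← h]
      ext i c <;> fin_cases i <;> rfl
    · simp
  · symm
    trans 0
    · refine Finset.sum_eq_zero fun u _ => mul_eq_zero_of_right _ (if_neg fun h => hx ?_)
      rw [← h]
      exact ⟨rfl, rfl⟩
    · rcases not_and_or.mp hx with h | h
      · rw [if_neg h]; simp
      · rw [if_neg h]; simp

theorem distill_combinedOps (P : Projector) (p : ℝ)
    (A : Fin 2 → Matrix (Fin 2) (γ → Fin 2) ℂ) (B : Fin 2 → Matrix (Fin 2) (δ → Fin 2) ℂ) :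
    distill (combinedOps P A B) (noisy P p) =
      midOp P * tensorOp (distill A (noisy12 P p)) (distill B (noisy23 P p)) * (midOp P)ᴴ := by
  set E := (1 : Matrix (Fin 3 → γ ⊕ δ → Fin 2) (Fin 3 → γ ⊕ δ → Fin 2) ℂ).submatrix
    (combine (γ := γ) (δ := δ)) id with hE
  set Q := (Matrix.kronecker (localQubitOp A) (localQubitOp B)).submatrix splitFour id with hQ
  have h1 : E * tensorPower (γ ⊕ δ) (noisy P p) * Eᴴ =
      Matrix.kronecker (tensorPower γ (noisy12 P p)) (tensorPower δ (noisy23 P p)) := by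
    rw [← tensorPower_combine]
    ext u v
    simp [hE, Matrix.mul_apply, Matrix.one_apply, apply_ite]
  have h2 : Q * Matrix.kronecker (tensorPower γ (noisy12 P p)) (tensorPower δ (noisy23 P p)) * Qᴴ
      = tensorOp (distill A (noisy12 P p)) (distill B (noisy23 P p)) := by
    rw [tensorOp_eq_submatrix, distill, distill]
    unfold Matrix.kronecker
    rw [Matrix.mul_kronecker_mul,
      Matrix.mul_kronecker_mul, ← Matrix.conjTranspose_kronecker]
    rfl
  rw [← h2, ← h1, distill, localQubitOp_combinedOps, Matrix.conjTranspose_mul,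
    Matrix.conjTranspose_mul]
  simp only [Matrix.mul_assoc]
  rfl

end Combine

theorem drppOptimal_of_reconstructs {P : Projector} (hs : IsUnit (slice P 0))
    (hc : IsUnit (coslice P 0)) (h12 : ∃ P₁, Reconstructs12 P P₁)
    (h23 : ∃ P₁, Reconstructs23 P P₁) : DRPPOptimal P := by
  have hv := vbs_ne_zero hs
  intro p h0 h1
  have hp12 := noisy12_posSemidef P h0 h1
  have hp23 := noisy23_posSemidef P h0 h1
  constructor
  · intro h ε hε
    obtain ⟨δ, hδ, hδε, H⟩ := exists_isClose_midOp hv hε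
    obtain ⟨n, S, hS⟩ := purifiable_noisy12_of_reconstructs hs h12 h0 h1 h δ hδ
    obtain ⟨m, T, hT⟩ := purifiable_noisy23_of_reconstructs hc h23 h0 h1 h δ hδ
    exact ⟨n, m, S, T, hS.mono hδε, hT.mono hδε, H _ _
      (S.run_posSemidef (copies_posSemidef n hp12)) (T.run_posSemidef (copies_posSemidef m hp23))
      hS hT⟩
  · intro h
    refine purifiable_of_distill fun ε hε => ?_
    obtain ⟨δ, hδ, -, H⟩ := exists_isClose_midOp hv hε
    -- Closeness of the combined output concerns all of `S` and `T`; for the single branches chosen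
    -- next it is derived anew from `H`.
    obtain ⟨n, m, S, T, hS, hT, -⟩ := h δ hδ
    obtain ⟨A, hA⟩ := exists_isClose_distill S bell_ne_zero hp12 hS
    obtain ⟨B, hB⟩ := exists_isClose_distill T bell_ne_zero hp23 hT
    refine ⟨Fin n ⊕ Fin m, inferInstance, inferInstance, combinedOps P A B, ?_⟩
    rw [distill_combinedOps]
    exact H _ _ (distill_posSemidef A hp12) (distill_posSemidef B hp23) hA hB

theorem exists_reconstructs12_family {a b c : Fin 2 → ℂ}
    (h : ∀ j, a j ≠ 0 ∧ b j ≠ 0 ∧ c j ≠ 0) : ∃ P₁, Reconstructs12 (family a b c) P₁ :=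
  exists_reconstructs12_of_rescaling (exists_rescaling_family fun j => (h j).2)

theorem exists_reconstructs23_family {a b c : Fin 2 → ℂ}
    (h : ∀ j, a j ≠ 0 ∧ b j ≠ 0 ∧ c j ≠ 0) : ∃ P₁, Reconstructs23 (family a b c) P₁ := by
  rw [exists_reconstructs23_iff, mirror_family]
  exact exists_reconstructs12_family fun j => ⟨(h j).2.1, (h j).1, (h j).2.2⟩

theorem drppOptimal_family {a b c : Fin 2 → ℂ} (h : ∀ j, a j ≠ 0 ∧ b j ≠ 0 ∧ c j ≠ 0)
    (hac : a 0 * c 1 ≠ a 1 * c 0) (hbc : b 0 * c 1 ≠ b 1 * c 0) :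
    DRPPOptimal (family a b c) := by
  refine drppOptimal_of_reconstructs (isUnit_slice_family (fun j => (h j).2) hac) ?_
    (exists_reconstructs12_family h) (exists_reconstructs23_family h)
  rw [← slice_mirror, mirror_family]
  exact isUnit_slice_family (fun j => ⟨(h j).1, (h j).2.2⟩) hbc

/-! ### Weighted graph states -/

theorem vbs_weightedProjector (θ₁ θ₂ : ℝ) : vbs (weightedProjector θ₁ θ₂) =
    ((√2 : ℝ) : ℂ) ^ 3 • weightedGraphState θ₁ θ₂ := by
  have h2 : ((√2 : ℝ) : ℂ) ^ 3 * ((1 / √2 : ℝ) : ℂ) ^ 3 = 1 := by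
    rw [← mul_pow, ← Complex.ofReal_mul, mul_one_div_cancel (by positivity)]
    simp
  ext x
  rw [vbs_apply, Pi.smul_apply, weightedGraphState, controlledPhase, controlledPhase,
    Matrix.mulVec_diagonal, Matrix.mulVec_diagonal, plus, smul_eq_mul, mul_left_comm,
    mul_left_comm _ _ (((1 / √2 : ℝ) : ℂ) ^ 3), h2, mul_one]
  have hexp : Complex.exp ((θ₁ + θ₂) * Complex.I)
      = Complex.exp (θ₁ * Complex.I) * Complex.exp (θ₂ * Complex.I) := by
    rw [← Complex.exp_add]; ring_nf
  have hx0 := Fin.exists_fin_two.mp ⟨x 0, rfl⟩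
  have hx1 := Fin.exists_fin_two.mp ⟨x 1, rfl⟩
  have hx2 := Fin.exists_fin_two.mp ⟨x 2, rfl⟩
  rcases hx0 with h | h <;> rcases hx1 with h' | h' <;> rcases hx2 with h'' | h'' <;>
    simp [weightedProjector, family, hexp, h, h', h'', Complex.exp_ne_zero] <;>
    exact mul_comm _ _

theorem drppOptimal_weightedProjector {θ₁ θ₂ : ℝ} (h₁ : Complex.exp (θ₁ * Complex.I) ≠ 1)
    (h₂ : Complex.exp (θ₂ * Complex.I) ≠ 1) : DRPPOptimal (weightedProjector θ₁ θ₂) := by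
  have hexp : Complex.exp ((θ₁ + θ₂) * Complex.I)
      = Complex.exp (θ₁ * Complex.I) * Complex.exp (θ₂ * Complex.I) := by
    rw [← Complex.exp_add]; ring_nf
  refine drppOptimal_family (fun j => ?_) ?_ ?_
  · fin_cases j <;> simp [Complex.exp_ne_zero]
  · simpa [hexp, Complex.exp_ne_zero] using h₂
  · simpa [hexp, Complex.exp_ne_zero] using h₁

theorem weightedGraphState_pi_pi :
    weightedGraphState Real.pi Real.pi = graphState (SimpleGraph.pathGraph 3) := by
  ext x
  rw [weightedGraphState, controlledPhase, controlledPhase, Matrix.mulVec_diagonal,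
    Matrix.mulVec_diagonal, graphState, ← mul_assoc, Complex.exp_pi_mul_I]
  congr 1
  simp [Fin.prod_univ_three, SimpleGraph.pathGraph_adj]

/-! ### A valence bond state that is not a graph state -/

/-- The amplitudes of three qubits as a matrix from the last two to the first. -/
def amplitudes (ψ : Ket (Fin 3)) : Matrix (Fin 2) (Fin 2 × Fin 2) ℂ :=
  Matrix.of fun i jk => ψ ![i, jk.1, jk.2]

/-- The unnormalised reduced state of the first of three qubits. -/
def reduced (ψ : Ket (Fin 3)) : Matrix (Fin 2) (Fin 2) ℂ := amplitudes ψ * (amplitudes ψ)ᴴ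

theorem amplitudes_localOp (U : Fin 3 → Matrix (Fin 2) (Fin 2) ℂ) (z : ℂ) (ψ : Ket (Fin 3)) :
    amplitudes (z • (localOp (d := fun _ => 2) (e := fun _ => 2) U *ᵥ ψ)) =
      z • (U 0 * amplitudes ψ * (Matrix.kronecker (U 1) (U 2))ᵀ) := by
  ext i ⟨j, k⟩
  simp only [amplitudes, Matrix.of_apply, Matrix.smul_apply, Pi.smul_apply, Matrix.mulVec,
    dotProduct, Matrix.mul_apply, localOp, Fin.prod_univ_three, Matrix.transpose_apply,
    Matrix.kronecker, Matrix.kroneckerMap_apply, Finset.sum_mul]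
  congr 1
  refine (sum_fin_three_arrow (α := Fin 2) _).trans ?_
  symm
  rw [Finset.sum_comm]
  refine Finset.sum_congr rfl fun a _ => ?_
  rw [Fintype.sum_prod_type]
  refine Finset.sum_congr rfl fun b _ => Finset.sum_congr rfl fun c _ => ?_
  simp only [Matrix.cons_val]
  ring

/-- Unitaries on the traced-out qubits cancel; the first one acts by conjugation. -/
theorem reduced_localOp (U : Fin 3 → Matrix.unitaryGroup (Fin 2) ℂ) (z : ℂ) (ψ : Ket (Fin 3)) :
    reduced (z • (localOp (d := fun _ => 2) (e := fun _ => 2)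
      (fun q => (U q : Matrix (Fin 2) (Fin 2) ℂ)) *ᵥ ψ)) =
      (z * star z) • ((U 0 : Matrix (Fin 2) (Fin 2) ℂ) * reduced ψ *
        (U 0 : Matrix (Fin 2) (Fin 2) ℂ)ᴴ) := by
  have hU : ∀ q, (U q : Matrix (Fin 2) (Fin 2) ℂ)ᴴ * U q = 1 :=
    fun q => Matrix.UnitaryGroup.star_mul_self (U q)
  set W := Matrix.kronecker (U 1 : Matrix (Fin 2) (Fin 2) ℂ) (U 2 : Matrix (Fin 2) (Fin 2) ℂ)
    with hW
  have hW1 : Wᴴ * W = 1 := by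
    rw [hW]
    unfold Matrix.kronecker
    rw [Matrix.conjTranspose_kronecker, ← Matrix.mul_kronecker_mul, hU, hU,
      Matrix.one_kronecker_one]
  have hW2 : Wᵀ * (Wᵀ)ᴴ = 1 := by
    have : (Wᵀ)ᴴ = (Wᴴ)ᵀ := rfl
    rw [this, ← Matrix.transpose_mul, hW1, Matrix.transpose_one]
  rw [reduced, amplitudes_localOp, ← hW, reduced, Matrix.conjTranspose_smul, Matrix.smul_mul,
    Matrix.mul_smul, smul_smul, Matrix.conjTranspose_mul, Matrix.conjTranspose_mul]
  congr 1
  calc _ = (U 0 : Matrix (Fin 2) (Fin 2) ℂ) * amplitudes ψ * (Wᵀ * (Wᵀ)ᴴ) *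
        ((amplitudes ψ)ᴴ * (U 0 : Matrix (Fin 2) (Fin 2) ℂ)ᴴ) := by simp only [Matrix.mul_assoc]
    _ = _ := by rw [hW2, Matrix.mul_one]; simp only [Matrix.mul_assoc]

/-- Every qubit of a graph state is either maximally mixed or pure. -/
theorem reduced_graphState (G : SimpleGraph (Fin 3)) :
    (reduced (graphState G)).det = 0 ∨
      4 * (reduced (graphState G)).det = (reduced (graphState G)).trace ^ 2 := by
  classical
  generalize hw : ((1 / √2 : ℝ) : ℂ) ^ 3 = w
  have hg : ∀ i j k : Fin 2, graphState G ![i, j, k] =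
      (if G.Adj 0 2 ∧ i = 1 ∧ k = 1 then -1 else 1) *
      (if G.Adj 0 1 ∧ i = 1 ∧ j = 1 then -1 else 1) *
      (if G.Adj 1 2 ∧ j = 1 ∧ k = 1 then -1 else 1) * w := by
    intro i j k
    simp [graphState, Fin.prod_univ_three, plus, ← hw]
  simp only [Matrix.det_fin_two, Matrix.trace_fin_two, reduced, amplitudes, Matrix.mul_apply,
    Matrix.of_apply, Matrix.conjTranspose_apply, Fintype.sum_prod_type, Fin.sum_univ_two, hg]
  by_cases h1 : G.Adj 0 1 <;> by_cases h2 : G.Adj 0 2 <;> by_cases h3 : G.Adj 1 2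
  all_goals
    first
    | (left; simp [h1, h2, h3]; done)
    | (right; simp [h1, h2, h3]; done)
    | (right; simp [h1, h2, h3]; ring)

/-- Both alternatives are invariant under unitary conjugation and homogeneous of degree two, so they
pass from the graph state to `ψ`. -/
theorem reduced_of_isLocallyGraphState {ψ : Ket (Fin 3)} (h : IsLocallyGraphState ψ) :
    (reduced ψ).det = 0 ∨ 4 * (reduced ψ).det = (reduced ψ).trace ^ 2 := by
  obtain ⟨G, U, z, rfl⟩ := h
  have hU : (U 0 : Matrix (Fin 2) (Fin 2) ℂ)ᴴ * U 0 = 1 :=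
    Matrix.UnitaryGroup.star_mul_self (U 0)
  rw [reduced_localOp]
  have htr : ((U 0 : Matrix (Fin 2) (Fin 2) ℂ) * reduced (graphState G) *
      (U 0 : Matrix (Fin 2) (Fin 2) ℂ)ᴴ).trace = (reduced (graphState G)).trace := by
    rw [Matrix.trace_mul_comm, ← Matrix.mul_assoc, hU, Matrix.one_mul]
  have hdet : ((U 0 : Matrix (Fin 2) (Fin 2) ℂ) * reduced (graphState G) *
      (U 0 : Matrix (Fin 2) (Fin 2) ℂ)ᴴ).det = (reduced (graphState G)).det := by
    rw [Matrix.det_mul_comm, ← Matrix.mul_assoc, hU, Matrix.one_mul]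
  rw [Matrix.det_smul, Matrix.trace_smul, htr, hdet, Fintype.card_fin, smul_eq_mul]
  rcases reduced_graphState G with h | h
  · left; rw [h, mul_zero]
  · right; linear_combination (z * star z) ^ 2 * h

/-- The reduced matrix is `!![7, 12; 12, 22]`, with determinant `10` and trace `29`: neither `10 =
0` nor `40 = 841`. -/
theorem not_isLocallyGraphState_family :
    ¬ IsLocallyGraphState (vbs (family ![1, 2] ![1, 2] ![1, 4])) := by
  intro h
  have h2 := reduced_of_isLocallyGraphState h
  simp only [Matrix.det_fin_two, Matrix.trace_fin_two, reduced, amplitudes, Matrix.mul_apply,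
    Matrix.of_apply, Matrix.conjTranspose_apply, Fintype.sum_prod_type, Fin.sum_univ_two,
    vbs_apply, family, Matrix.cons_val] at h2
  norm_num at h2

end VBS

theorem mainTheorem7 :
    -- the reconstruction conditions in terms of the matrices `α^i`, `β^i`, on either edge
    (∀ P₀ P₁ : VBS.Projector,
      (VBS.Reconstructs12 P₀ P₁ ↔
        (∀ i, VBS.slice P₁ i * VBS.slice P₀ 0 = VBS.slice P₀ i) ∧
        (∀ i, (VBS.slice P₁ i * VBS.pauliZ - VBS.pauliZ * VBS.slice P₁ i) * VBS.slice P₀ 0 = 0)) ∧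
      (VBS.Reconstructs23 P₀ P₁ ↔
        (∀ i, VBS.coslice P₁ i * VBS.coslice P₀ 0 = VBS.coslice P₀ i) ∧
        (∀ i, (VBS.coslice P₁ i * VBS.pauliZ - VBS.pauliZ * VBS.coslice P₁ i) *
          VBS.coslice P₀ 0 = 0))) ∧
    -- a reconstruction on one edge bounds all purification protocols by that edge
    (∀ P₀ : VBS.Projector, IsUnit (VBS.slice P₀ 0) → (∃ P₁, VBS.Reconstructs12 P₀ P₁) →
      ∀ p : ℝ, 0 ≤ p → p ≤ 1 → VBS.Purifiable (VBS.noisy P₀ p) (VBS.vbs P₀) →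
        VBS.Purifiable (VBS.noisy12 P₀ p) VBS.bell) ∧
    (∀ P₀ : VBS.Projector, IsUnit (VBS.coslice P₀ 0) → (∃ P₁, VBS.Reconstructs23 P₀ P₁) →
      ∀ p : ℝ, 0 ≤ p → p ≤ 1 → VBS.Purifiable (VBS.noisy P₀ p) (VBS.vbs P₀) →
        VBS.Purifiable (VBS.noisy23 P₀ p) VBS.bell) ∧
    -- reconstructions on both edges make the divide and rebuild protocol optimal
    (∀ P₀ : VBS.Projector, IsUnit (VBS.slice P₀ 0) → IsUnit (VBS.coslice P₀ 0) →
      (∃ P₁, VBS.Reconstructs12 P₀ P₁) → (∃ P₁, VBS.Reconstructs23 P₀ P₁) →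
      VBS.DRPPOptimal P₀) ∧
    -- the diagonality criterion on either edge
    (∀ P₀ : VBS.Projector, IsUnit (VBS.slice P₀ 0) → IsUnit (VBS.slice P₀ 1) →
      ((∃ P₁, VBS.Reconstructs12 P₀ P₁) ↔ (VBS.slice P₀ 0 * (VBS.slice P₀ 1)⁻¹).IsDiag)) ∧
    (∀ P₀ : VBS.Projector, IsUnit (VBS.coslice P₀ 0) → IsUnit (VBS.coslice P₀ 1) →
      ((∃ P₁, VBS.Reconstructs23 P₀ P₁) ↔ (VBS.coslice P₀ 0 * (VBS.coslice P₀ 1)⁻¹).IsDiag)) ∧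
    -- the final form of the projector
    (∀ P₀ : VBS.Projector, (∀ k, IsUnit (VBS.slice P₀ k)) → (∀ i, IsUnit (VBS.coslice P₀ i)) →
      ((∃ P₁, VBS.Reconstructs12 P₀ P₁) ↔ ∃ a b c, (∀ j, c j ≠ 0) ∧ P₀ = VBS.family a b c) ∧
      ((∃ P₁, VBS.Reconstructs23 P₀ P₁) ↔ ∃ a b c, (∀ j, c j ≠ 0) ∧ P₀ = VBS.family a b c)) ∧
    (∀ a b c : Fin 2 → ℂ, (∀ j, a j ≠ 0 ∧ b j ≠ 0 ∧ c j ≠ 0) →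
      (∃ P₁, VBS.Reconstructs12 (VBS.family a b c) P₁) ∧
      (∃ P₁, VBS.Reconstructs23 (VBS.family a b c) P₁) ∧
      (a 0 * c 1 ≠ a 1 * c 0 → b 0 * c 1 ≠ b 1 * c 0 → VBS.DRPPOptimal (VBS.family a b c))) ∧
    -- weighted graph states, and the cluster state
    (∀ θ₁ θ₂ : ℝ,
      VBS.vbs (VBS.weightedProjector θ₁ θ₂) =
        ((√2 : ℝ) : ℂ) ^ 3 • VBS.weightedGraphState θ₁ θ₂ ∧
      (Complex.exp (θ₁ * Complex.I) ≠ 1 → Complex.exp (θ₂ * Complex.I) ≠ 1 →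
        VBS.DRPPOptimal (VBS.weightedProjector θ₁ θ₂))) ∧
    VBS.weightedGraphState Real.pi Real.pi = VBS.graphState (SimpleGraph.pathGraph 3) ∧
    -- an optimally purifiable valence bond state that is not a graph state
    (∃ a b c : Fin 2 → ℂ, (∀ j, a j ≠ 0 ∧ b j ≠ 0 ∧ c j ≠ 0) ∧
      VBS.DRPPOptimal (VBS.family a b c) ∧
      ¬ VBS.IsLocallyGraphState (VBS.vbs (VBS.family a b c))) := by
  refine ⟨fun P₀ P₁ => ⟨VBS.reconstructs12_iff P₀ P₁, VBS.reconstructs23_iff P₀ P₁⟩,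
    fun _ hP hr _ h0 h1 h => VBS.purifiable_noisy12_of_reconstructs hP hr h0 h1 h,
    fun _ hP hr _ h0 h1 h => VBS.purifiable_noisy23_of_reconstructs hP hr h0 h1 h,
    fun _ hs hc h12 h23 => VBS.drppOptimal_of_reconstructs hs hc h12 h23,
    fun _ h0 h1 => VBS.exists_reconstructs12_iff_isDiag h0 h1,
    fun P h0 h1 => (VBS.exists_reconstructs23_iff P).trans
      (VBS.exists_reconstructs12_iff_isDiag (P := VBS.mirror P) h0 h1),
    fun _ hs hc => ⟨VBS.exists_reconstructs12_iff_family hs hc,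
      VBS.exists_reconstructs23_iff_family hs hc⟩,
    fun _ _ _ h => ⟨VBS.exists_reconstructs12_family h, VBS.exists_reconstructs23_family h,
      VBS.drppOptimal_family h⟩,
    fun θ₁ θ₂ => ⟨VBS.vbs_weightedProjector θ₁ θ₂, VBS.drppOptimal_weightedProjector⟩,
    -- Here `a 0 * c 1 = 4` and `a 1 * c 0 = 2`, and likewise for `b`, so the optimality criterion
    -- applies.
    VBS.weightedGraphState_pi_pi, ![1, 2], ![1, 2], ![1, 4], fun j => ?_,
    VBS.drppOptimal_family (fun j => ?_) (by norm_num) (by norm_num),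
    VBS.not_isLocallyGraphState_family⟩ <;>
  fin_cases j <;> simp
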